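/- Let $d\ge 1$, $\lambda>0$, and let $L$ be a homogeneous Poisson process of intensity $\lambda$ on $\mathbb R^d$: a random set of points such that the number of points in each Borel set of finite volume is a Poisson random variable with mean $\lambda$ times the volume, and the numbers of points in disjoint such sets are independent. Misère friendly frogs on a set $L\subseteq\mathbb R^d$ is the following game. Alice places a frog at a point of $L$; Bob then places a second frog at a different point of $L$; thereafter the players, starting with Alice, take turns to move either one of the two frogs to another point of $L$ not occupied by the other frog, so that the Euclidean distance between the frogs strictly decreases. A player who is to move and cannot move wins. A strategy assigns to each position (the locations of $0$, $1$ or $2$ frogs) a legal move, if there is one; the game is a win for Bob if he has a strategy with which, whatever strategy Alice uses, the play ends after finitely many moves and Bob wins. Two distinct points $x,y\in L$ are mutually closest if $|x-y|\le|x-z|$ for all $z\in L\setminus\{x\}$ and $|x-y|\le|z-y|$ for all $z\in L\setminus\{y\}$. A matching of $L$ is a set of unordered pairs of distinct points of $L$ such that each point lies in at most one pair; it is perfect if each point lies in exactly one pair. For a matching $M$, let $M(x)$ be the partner of $x$, with $|x-M(x)|:=\infty$ if $x$ is unmatched. A restricted stable matching of $L$ is a matching $M$ of $L$ that contains no pair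 of mutually closest points and for which there are no two distinct points $x,y\in L$ that are not mutually closest and satisfy $|x-M(x)|>|x-y|$ and $|y-M(y)|>|x-y|$. Then, with probability $1$, misère friendly frogs on $L$ is a win for Bob; moreover, with probability $1$, $L$ has a unique restricted stable matching, and this matching is perfect. -/

import Mathlib

open MeasureTheory ProbabilityTheory
open scoped NNReal ENNReal

namespace FriendlyFrogs

/-! ## Two-player games and misère play

A game is given by a type `P` of positions and a relation `move p q`
(the player to move at `p` may move to `q`). -/

section Game

variable {P : Type*}

/-- A position from which there is no legal move. -/
def IsTerminal (move : P → P → Prop) (p : P) : Prop :=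
  ∀ q, ¬ move p q

/-- A strategy assigns a legal move, if one exists, to each position. -/
def IsStrategy (move : P → P → Prop) (σ : P → P) : Prop :=
  ∀ p, ¬ IsTerminal move p → move p (σ p)

/-- The positions reached from `start` when the first player uses `σ`, the second player uses `τ`,
and they alternate with the first player moving first: the first player is to move at even times,
the second player at odd times.  Only the part up to the first terminal position is relevant. -/
def play (σ τ : P → P) (start : P) : ℕ → P
  | 0 => start
  | n + 1 => if Even n then σ (play σ τ start n) else τ (play σ τ start n)

/-- The play `f` reaches a terminal position for the first time at time `n`. -/
def EndsAt (move : P → P → Prop) (f : ℕ → P) (n : ℕ) : Prop :=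
  IsTerminal move (f n) ∧ ∀ m < n, ¬ IsTerminal move (f m)

/-- The second player has a winning strategy under misère rules: whatever strategy the first player
uses, the play ends, at an (odd) time when it is the second player who cannot move, and who
therefore wins. -/
def MisereWinForSecond (move : P → P → Prop) (start : P) : Prop :=
  ∃ τ : P → P, IsStrategy move τ ∧
    ∀ σ : P → P, IsStrategy move σ →
      ∃ n, Odd n ∧ EndsAt move (play σ τ start) n

end Game

/-! ## Friendly frogs and the restricted stable matching on a set `L` of points -/

section Frogs

variable {E : Type*} [MetricSpace E]

/-- A position consists of the locations, at distinct points of `L`, of `0`, `1` or `2` frogs. -/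
inductive Position (L : Set E) : Type _
  | zero : Position L
  | one (x : L) : Position L
  | two (x y : L) (hne : x ≠ y) : Position L

/-- The legal moves of friendly frogs: the first frog is placed at any point of `L`, the second one
at any other point; afterwards, either frog jumps to a point of `L` not occupied by the other frog
so that the distance between the frogs strictly decreases. -/
inductive Move (L : Set E) : Position L → Position L → Prop
  | placeFirst (x : L) : Move L Position.zero (Position.one x)
  | placeSecond (x y : L) (h : x ≠ y) : Move L (Position.one x) (Position.two x y h)
  | jumpFirst (x y x' : L) (h : x ≠ y) (h' : x' ≠ y) (hd : dist x' y < dist x y) :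
      Move L (Position.two x y h) (Position.two x' y h')
  | jumpSecond (x y y' : L) (h : x ≠ y) (h' : x ≠ y') (hd : dist x y' < dist x y) :
      Move L (Position.two x y h) (Position.two x y' h')

/-- Misère friendly frogs on `L` is a win for Bob (Alice places the first frog). -/
def MisereWinForBob (L : Set E) : Prop :=
  MisereWinForSecond (Move L) Position.zero

/-- A matching of `L`: a set of unordered pairs of distinct points of `L` such that each point is
included in at most one pair. -/
structure IsMatching (L : Set E) (M : Set (Sym2 E)) : Prop where
  mem_and_ne : ∀ x y, s(x, y) ∈ M → x ∈ L ∧ y ∈ L ∧ x ≠ y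
  partner_unique : ∀ x y z, s(x, y) ∈ M → s(x, z) ∈ M → y = z

/-- Every point of `L` is included in a pair of `M`. -/
def Covers (L : Set E) (M : Set (Sym2 E)) : Prop :=
  ∀ x ∈ L, ∃ y, s(x, y) ∈ M

/-- `x` and `y` are distinct points of `L`, each closest to the other among the other points
of `L`. -/
def MutuallyClosest (L : Set E) (x y : E) : Prop :=
  x ∈ L ∧ y ∈ L ∧ x ≠ y ∧
    (∀ z ∈ L, z ≠ x → dist x y ≤ dist x z) ∧ (∀ z ∈ L, z ≠ y → dist x y ≤ dist z y)

/-- `x` strictly prefers `y` to its partner in `M`; this holds if `x` is unmatched. -/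
def Prefers (M : Set (Sym2 E)) (x y : E) : Prop :=
  ∀ z, s(x, z) ∈ M → dist x y < dist x z

/-- A stable matching of `L` subject to the restriction that mutually closest points cannot be
matched: a matching without mutually closest pairs such that no two distinct points of `L` that are
not mutually closest strictly prefer each other to their own partners. -/
structure IsRestrictedStableMatching (L : Set E) (M : Set (Sym2 E)) : Prop where
  isMatching : IsMatching L M
  restricted : ∀ x y, s(x, y) ∈ M → ¬ MutuallyClosest L x y
  stable : ∀ x ∈ L, ∀ y ∈ L, x ≠ y → ¬ MutuallyClosest L x y →
    ¬ (Prefers M x y ∧ Prefers M y x)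

end Frogs

/-! ## Poisson processes -/

/-- The random set `L` is a homogeneous Poisson process of intensity `lam` on `ℝ^d`: the number of
points in each Borel set of finite volume is a random variable with the Poisson distribution of mean
`lam` times the volume, and the numbers of points in disjoint such sets are independent. -/
structure IsPoissonProcess {Ω : Type*} [MeasurableSpace Ω] (μ : Measure Ω) {d : ℕ} (lam : ℝ≥0)
    (L : Ω → Set (EuclideanSpace ℝ (Fin d))) : Prop where
  measurable_count : ∀ B : Set (EuclideanSpace ℝ (Fin d)), MeasurableSet B → volume B < ∞ →
    Measurable fun ω => (L ω ∩ B).encard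
  law_count : ∀ B : Set (EuclideanSpace ℝ (Fin d)), MeasurableSet B → volume B < ∞ →
    μ.map (fun ω => (L ω ∩ B).encard) =
      (poissonMeasure (lam * (volume B).toNNReal)).map (fun n : ℕ => (n : ℕ∞))
  indep_count : ∀ (n : ℕ) (B : Fin n → Set (EuclideanSpace ℝ (Fin d))),
    (∀ i, MeasurableSet (B i)) → (∀ i, volume (B i) < ∞) →
    (∀ i j, i ≠ j → Disjoint (B i) (B j)) →
    iIndepFun (fun i ω => (L ω ∩ B i).encard) μ

end FriendlyFrogs

/-!
Call a pair of points *losing* if it is not mutually closest (under misère rules the player to move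
wins there) and no jump leads from it to a losing pair. Suppose that `L` is locally finite, has no
isosceles triangles, and admits no infinite sequence of jumps (`Generic`). Then this recursion has a
unique solution `Losing`, and a set of pairs is a restricted stable matching if and only if it
satisfies the recursion (`Generic.mem_iff_of_isRestrictedStableMatching`); so the losing pairs form
the unique restricted stable matching. If it is perfect, then Bob wins by always moving to a losing
pair (`Generic.misereWinForBob`).

A Poisson process is almost surely generic. All three properties follow from a first-moment bound:
the probability that some `k`-tuple of distinct points of the process lies in `T ⊆ (ℝ^d)^k` is at
most `lam ^ k * volume T` (`IsPoissonProcess.measure_exists_tuple_le`). Isosceles triples form a null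
set. In an infinite sequence of jumps the distances decrease to a limit `l`, and eventually all of
them lie in a short interval around `l`. For a short enough interval the graph of all edges with
such lengths is subcritical, so that its components are finite (`IsPoissonProcess.ae_exists_not_path`,
`wellFounded_step`), and only finitely many pairs are visited.

The matching is perfect by translation invariance. Two unmatched points have to be mutually closest,
so there are only finitely many unmatched points (`Generic.finite_unmatched`). On the other hand the
law of the process is translation invariant (`IsPoissonProcess.map_counts_eq`), hence the probability
that there is an unmatched point in a given ball does not change when the ball is moved to infinity;
it therefore vanishes (`IsPoissonProcess.ae_not_mem_unmatchedIn`). For this the event has to be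
measurable, which is why `Losing` is defined as a limit of finite-depth approximations: their
quantifiers over points of `L` can be replaced by quantifiers over a countable family of balls.
-/

namespace FriendlyFrogs

/-! ### The restricted stable matching of a generic set -/

section Deterministic

variable {E : Type*} [MetricSpace E] {s : Set E}

/-- `p` consists of two distinct points of `s`. -/
def IsPair (s : Set E) (p : E × E) : Prop :=
  p.1 ∈ s ∧ p.2 ∈ s ∧ p.1 ≠ p.2

/-- One jump of a frog leads from the pair `p` to the pair `q`. The mover goes second, as the
relation is used for well-founded induction. -/
def Step (s : Set E) (q p : E × E) : Prop :=
  IsPair s q ∧ (q.1 = p.1 ∨ q.2 = p.2) ∧ dist q.1 q.2 < dist p.1 p.2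

/-- The three properties of a Poisson process on which the game depends. -/
structure Generic (s : Set E) : Prop where
  locallyFinite : ∀ x r, (s ∩ Metric.closedBall x r).Finite
  not_isosceles : ∀ x ∈ s, ∀ y ∈ s, ∀ z ∈ s, y ≠ z → dist x y ≠ dist x z
  wellFounded : WellFounded (Step s)

/-- The pairs from which the player to move loses, as computed by looking `n` moves ahead. -/
def LosingWithin (s : Set E) : ℕ → E × E → Prop
  | 0, _ => False
  | n + 1, p => IsPair s p ∧ (∃ q, Step s q p) ∧ ∀ q, Step s q p → ¬ LosingWithin s n q

/-- The pairs from which the player to move loses. Looking `n` moves ahead gives the correct answer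
for all large `n`; a definition by this limit, rather than by well-founded recursion, makes sense
for every `s` and is visibly a measurable function of `s`. -/
def Losing (s : Set E) (p : E × E) : Prop :=
  ∃ N, ∀ n ≥ N, LosingWithin s n p

lemma isPair_swap {α : Type*} {s : Set α} {p : α × α} : IsPair s p.swap ↔ IsPair s p := by
  simp only [IsPair, Prod.fst_swap, Prod.snd_swap, ne_comm (a := p.2)]
  tauto

lemma step_swap {p q : E × E} : Step s q.swap p.swap ↔ Step s q p := by
  simp only [Step, isPair_swap, Prod.fst_swap, Prod.snd_swap, dist_comm q.2, dist_comm p.2]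
  tauto

lemma losingWithin_swap (n : ℕ) : ∀ p : E × E, LosingWithin s n p.swap ↔ LosingWithin s n p := by
  induction n with
  | zero => exact fun _ => Iff.rfl
  | succ n ih =>
    intro p
    have key : ∀ {P : E × E → Prop}, (∀ q, P q) ↔ ∀ q, P (Prod.swap q) :=
      fun {P} => Prod.swap_surjective.forall
    have key' : ∀ {P : E × E → Prop}, (∃ q, P q) ↔ ∃ q, P (Prod.swap q) :=
      fun {P} => Prod.swap_surjective.exists
    simp only [LosingWithin, isPair_swap]
    rw [key, key']
    simp only [step_swap, ih]

lemma losing_swap {p : E × E} : Losing s p.swap ↔ Losing s p := by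
  simp only [Losing, losingWithin_swap]

lemma Losing.isPair {p : E × E} (h : Losing s p) : IsPair s p := by
  obtain ⟨N, hN⟩ := h
  exact (hN (N + 1) (by omega)).1

lemma not_mutuallyClosest_iff {x y : E} (h : IsPair s (x, y)) :
    ¬ MutuallyClosest s x y ↔ ∃ q, Step s q (x, y) := by
  obtain ⟨hx, hy, hxy⟩ := h
  simp only at hx hy hxy
  constructor
  · intro hm
    by_contra hno
    refine hm ⟨hx, hy, hxy, fun z hz hzx => ?_, fun z hz hzy => ?_⟩
    · by_contra! hlt
      exact hno ⟨(x, z), ⟨hx, hz, hzx.symm⟩, Or.inl rfl, hlt⟩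
    · by_contra! hlt
      exact hno ⟨(z, y), ⟨hz, hy, hzy⟩, Or.inr rfl, hlt⟩
  · rintro ⟨⟨a, b⟩, ⟨ha, hb, hab⟩, h | h, hlt⟩ hm <;> simp only at h hlt ha hb hab
    · subst h
      exact absurd (hm.2.2.2.1 b hb hab.symm) (not_le.2 hlt)
    · subst h
      exact absurd (hm.2.2.2.2 a ha hab) (not_le.2 hlt)

namespace Generic

lemma finite_step (hs : Generic s) (p : E × E) : {q | Step s q p}.Finite := by
  have h1 := hs.locallyFinite p.1 (dist p.1 p.2)
  have h2 := hs.locallyFinite p.2 (dist p.1 p.2)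
  refine ((h1.image fun z => (p.1, z)).union (h2.image fun z => (z, p.2))).subset ?_
  rintro ⟨a, b⟩ ⟨⟨ha, hb, -⟩, h | h, hlt⟩ <;> simp only at h hlt ha hb
  · subst h
    refine Or.inl ⟨b, ⟨hb, ?_⟩, rfl⟩
    rw [Metric.mem_closedBall, dist_comm]; exact hlt.le
  · subst h
    exact Or.inr ⟨a, ⟨ha, hlt.le⟩, rfl⟩

/-- Looking further ahead eventually does not change the verdict: by local finiteness the game from
`p` on has only finitely many continuations. -/
lemma losingWithin_stabilizes (hs : Generic s) (p : E × E) :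
    ∃ N, ∀ n ≥ N, (LosingWithin s n p ↔ LosingWithin s N p) := by
  induction p using hs.wellFounded.induction with
  | _ p ih =>
    choose! N hN using ih
    obtain ⟨K, hK⟩ := ((hs.finite_step p).image N).bddAbove
    have hstab : ∀ n ≥ K, ∀ q, Step s q p → (LosingWithin s n q ↔ LosingWithin s K q) := by
      intro n hn q hq
      have hqK : N q ≤ K := hK ⟨q, hq, rfl⟩
      rw [hN q hq n (hqK.trans hn), hN q hq K hqK]
    refine ⟨K + 1, fun n hn => ?_⟩
    obtain ⟨m, rfl⟩ : ∃ m, n = m + 1 := ⟨n - 1, by omega⟩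
    simp only [LosingWithin]
    refine and_congr_right fun _ => and_congr_right fun _ => forall_congr' fun q => ?_
    refine forall_congr' fun hq => not_congr ?_
    exact hstab m (by omega) q hq

/-- The recursion that characterizes the losing pairs under misère rules. -/
lemma losing_iff (hs : Generic s) (p : E × E) :
    Losing s p ↔ IsPair s p ∧ (∃ q, Step s q p) ∧ ∀ q, Step s q p → ¬ Losing s q := by
  constructor
  · rintro ⟨N, hN⟩
    refine ⟨(hN (N + 1) (by omega)).1, (hN (N + 1) (by omega)).2.1, ?_⟩
    rintro q hq ⟨N', hN'⟩
    exact (hN (max N N' + 1) (by omega)).2.2 q hq (hN' _ (le_max_right _ _))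
  · rintro ⟨hp, hex, hall⟩
    obtain ⟨N, hN⟩ := hs.losingWithin_stabilizes p
    by_cases h : LosingWithin s N p
    · exact ⟨N, fun n hn => (hN n hn).2 h⟩
    · exfalso
      choose K hK using fun q => hs.losingWithin_stabilizes q
      obtain ⟨B, hB⟩ := ((hs.finite_step p).image K).bddAbove
      have h' := mt (hN (max N B + 1) (by omega)).1 h
      refine h' ⟨hp, hex, fun q hq hl => hall q hq ⟨K q, fun n hn => ?_⟩⟩
      have hqB : K q ≤ B := hB ⟨q, hq, rfl⟩
      rw [hK q n hn, ← hK q (max N B) (hqB.trans (le_max_right _ _))]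
      exact hl

end Generic

/-- The matching formed by the losing pairs. -/
def losingMatching (s : Set E) : Set (Sym2 E) :=
  {e | ∃ p : E × E, e = s(p.1, p.2) ∧ Losing s p}

lemma mem_losingMatching {x y : E} : s(x, y) ∈ losingMatching s ↔ Losing s (x, y) := by
  constructor
  · rintro ⟨⟨a, b⟩, h, hl⟩
    rcases Sym2.eq_iff.1 h with ⟨rfl, rfl⟩ | ⟨rfl, rfl⟩
    · exact hl
    · exact losing_swap.1 hl
  · exact fun h => ⟨(x, y), rfl, h⟩

namespace Generic

/-- Two points that are not mutually closest, and neither of which has a closer partner among the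
losing pairs, form a losing pair. -/
lemma losing_of_prefers (hs : Generic s) {x y : E} (hp : IsPair s (x, y))
    (hm : ¬ MutuallyClosest s x y) (hx : ∀ z, Losing s (x, z) → dist x y ≤ dist x z)
    (hy : ∀ z, Losing s (y, z) → dist x y ≤ dist y z) : Losing s (x, y) := by
  refine (hs.losing_iff _).2 ⟨hp, (not_mutuallyClosest_iff hp).1 hm, ?_⟩
  rintro ⟨a, b⟩ ⟨-, h | h, hlt⟩ hl <;> simp only at h hlt
  · subst h
    exact absurd (hx b hl) (not_le.2 hlt)
  · subst h
    have := hy a (losing_swap.1 hl)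
    rw [dist_comm b a] at this
    exact absurd this (not_le.2 hlt)

lemma losing_unique (hs : Generic s) {x y z : E} (hy : Losing s (x, y)) (hz : Losing s (x, z)) :
    y = z := by
  by_contra hne
  rcases lt_or_gt_of_ne (hs.not_isosceles x hy.isPair.1 y hy.isPair.2.1 z hz.isPair.2.1 hne) with
    h | h
  · exact ((hs.losing_iff _).1 hz).2.2 (x, y) ⟨hy.isPair, Or.inl rfl, h⟩ hy
  · exact ((hs.losing_iff _).1 hy).2.2 (x, z) ⟨hz.isPair, Or.inl rfl, h⟩ hz

lemma isRestrictedStableMatching_losingMatching (hs : Generic s) :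
    IsRestrictedStableMatching s (losingMatching s) where
  isMatching :=
    { mem_and_ne := fun x y h => (mem_losingMatching.1 h).isPair
      partner_unique := fun x y z hy hz =>
        hs.losing_unique (mem_losingMatching.1 hy) (mem_losingMatching.1 hz) }
  restricted := fun x y h => by
    have h := mem_losingMatching.1 h
    exact (not_mutuallyClosest_iff h.isPair).2 ((hs.losing_iff _).1 h).2.1
  stable := by
    rintro x hx y hy hne hm ⟨hpx, hpy⟩
    have hl : Losing s (x, y) := by
      refine hs.losing_of_prefers ⟨hx, hy, hne⟩ hm (fun z hz => ?_) (fun z hz => ?_)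
      · exact (hpx z (mem_losingMatching.2 hz)).le
      · rw [dist_comm]
        exact (hpy z (mem_losingMatching.2 hz)).le
    exact lt_irrefl _ (hpx y (mem_losingMatching.2 hl))

/-- The pairs of a restricted stable matching satisfy the recursion for the losing pairs. -/
lemma mem_iff_of_isRestrictedStableMatching (hs : Generic s) {M : Set (Sym2 E)}
    (hM : IsRestrictedStableMatching s M) (p : E × E) :
    s(p.1, p.2) ∈ M ↔
      IsPair s p ∧ (∃ q, Step s q p) ∧ ∀ q, Step s q p → s(q.1, q.2) ∉ M := by
  obtain ⟨x, y⟩ := p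
  simp only
  constructor
  · intro h
    have hp : IsPair s (x, y) := hM.isMatching.mem_and_ne x y h
    refine ⟨hp, (not_mutuallyClosest_iff hp).1 (hM.restricted x y h), ?_⟩
    rintro ⟨a, b⟩ ⟨-, hab | hab, hlt⟩ hq <;> simp only at hab hlt hq
    · subst hab
      rw [hM.isMatching.partner_unique _ _ _ h hq] at hlt
      exact lt_irrefl _ hlt
    · subst hab
      rw [Sym2.eq_swap] at h hq
      rw [hM.isMatching.partner_unique _ _ _ h hq] at hlt
      exact lt_irrefl _ hlt
  · rintro ⟨hp, hex, hall⟩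
    by_contra hn
    obtain ⟨hx, hy, hne⟩ := hp
    simp only at hx hy hne
    -- An endpoint without preference has a partner that is no further away, hence, in the absence
    -- of isosceles triples, one that is closer.
    have aux : ∀ a ∈ s, ∀ b ∈ s, s(a, b) ∉ M → ¬ Prefers M a b →
        ∃ z, IsPair s (a, z) ∧ s(a, z) ∈ M ∧ dist a z < dist a b := by
      intro a ha b hb hab hnp
      simp only [Prefers, not_forall, not_lt] at hnp
      obtain ⟨z, hz, hle⟩ := hnp
      have hpz := hM.isMatching.mem_and_ne a z hz
      have hzb : z ≠ b := by rintro rfl; exact hab hz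
      exact ⟨z, hpz, hz, lt_of_le_of_ne hle (hs.not_isosceles a ha z hpz.2.1 b hb hzb)⟩
    by_cases h1 : Prefers M x y
    · by_cases h2 : Prefers M y x
      · exact hM.stable x hx y hy hne ((not_mutuallyClosest_iff ⟨hx, hy, hne⟩).2 hex) ⟨h1, h2⟩
      · obtain ⟨z, hpz, hz, hlt⟩ := aux y hy x hx (by rwa [Sym2.eq_swap]) h2
        refine hall (z, y) ⟨isPair_swap.2 hpz, Or.inr rfl, ?_⟩ (by rwa [Sym2.eq_swap])
        rwa [dist_comm z, dist_comm x]
    · obtain ⟨z, hpz, hz, hlt⟩ := aux x hx y hy hn h1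
      exact hall (x, z) ⟨hpz, Or.inl rfl, hlt⟩ hz

/-- Uniqueness: the recursion has only one solution, since sequences of jumps terminate. -/
lemma eq_losingMatching (hs : Generic s) {M : Set (Sym2 E)}
    (hM : IsRestrictedStableMatching s M) : M = losingMatching s := by
  have key : ∀ p : E × E, s(p.1, p.2) ∈ M ↔ Losing s p := by
    intro p
    induction p using hs.wellFounded.induction with
    | _ p ih =>
      rw [hs.mem_iff_of_isRestrictedStableMatching hM, hs.losing_iff]
      refine and_congr_right fun _ => and_congr_right fun _ => forall_congr' fun q => ?_
      exact forall_congr' fun hq => not_congr (ih q hq)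
  ext e
  induction e with
  | _ x y => rw [mem_losingMatching, ← key]

/-- All unmatched points other than a given one are mutually closest with it, and hence lie at the
same distance from it. -/
lemma finite_unmatched (hs : Generic s) : {x | x ∈ s ∧ ∀ y, ¬ Losing s (x, y)}.Finite := by
  rcases Set.eq_empty_or_nonempty {x | x ∈ s ∧ ∀ y, ¬ Losing s (x, y)} with h | ⟨x, hx, hxu⟩
  · rw [h]; exact Set.finite_empty
  have hmc : ∀ y ∈ s, (∀ z, ¬ Losing s (y, z)) → y ≠ x → MutuallyClosest s x y := by
    intro y hy hyu hne
    by_contra hm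
    exact hxu y (hs.losing_of_prefers ⟨hx, hy, hne.symm⟩ hm (fun z hz => absurd hz (hxu z))
      (fun z hz => absurd hz (hyu z)))
  have hsub : {y | (y ∈ s ∧ ∀ z, ¬ Losing s (y, z)) ∧ y ≠ x}.Subsingleton := by
    rintro y ⟨⟨hy, hyu⟩, hyx⟩ z ⟨⟨hz, hzu⟩, hzx⟩
    by_contra hne
    refine hs.not_isosceles x hx y hy z hz hne (le_antisymm ?_ ?_)
    · exact (hmc y hy hyu hyx).2.2.2.1 z hz hzx
    · exact (hmc z hz hzu hzx).2.2.2.1 y hy hyx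
  refine (hsub.finite.union (Set.finite_singleton x)).subset fun y hy => ?_
  by_cases h : y = x
  · exact Or.inr h
  · exact Or.inl ⟨hy, h⟩

end Generic

/-! ### Bob's strategy -/

/-- The positions that Bob aims at: two frogs on a losing pair. -/
def IsTarget {s : Set E} : Position s → Prop
  | .two x y _ => Losing s (x, y)
  | _ => False

/-- Every play of the game on a generic set is finite. -/
lemma Generic.wellFounded_move (hs : Generic s) :
    WellFounded fun q p : Position s => Move s p q := by
  have htwo : ∀ (p : E × E) (x y : s) (h : x ≠ y), (x.1, y.1) = p →
      Acc (fun q p : Position s => Move s p q) (Position.two x y h) := by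
    intro p
    induction p using hs.wellFounded.induction with
    | _ p ih =>
      rintro x y h rfl
      refine ⟨_, fun q hq => ?_⟩
      cases hq with
      | jumpFirst _ _ x' _ h' hd =>
        exact ih (x'.1, y.1) ⟨⟨x'.2, y.2, fun e => h' (Subtype.ext e)⟩, Or.inr rfl, hd⟩ _ _ _ rfl
      | jumpSecond _ _ y' _ h' hd =>
        exact ih (x.1, y'.1) ⟨⟨x.2, y'.2, fun e => h' (Subtype.ext e)⟩, Or.inl rfl, hd⟩ _ _ _ rfl
  have hone : ∀ x : s, Acc (fun q p : Position s => Move s p q) (Position.one x) := by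
    intro x
    refine ⟨_, fun q hq => ?_⟩
    cases hq with
    | placeSecond _ y h => exact htwo _ x y h rfl
  refine ⟨fun p => ?_⟩
  cases p with
  | zero =>
    refine ⟨_, fun q hq => ?_⟩
    cases hq with
    | placeFirst x => exact hone x
  | one x => exact hone x
  | two x y h => exact htwo _ x y h rfl

lemma Generic.not_isTerminal_of_isTarget (hs : Generic s) {p : Position s} (hp : IsTarget p) :
    ¬ IsTerminal (Move s) p := by
  cases p with
  | zero => exact hp.elim
  | one x => exact hp.elim
  | two x y h =>
    intro ht
    obtain ⟨-, ⟨⟨a, b⟩, ⟨ha, hb, hab⟩, h1 | h1, hlt⟩, -⟩ := (hs.losing_iff _).1 hp <;>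
      simp only at ha hb hab h1 hlt
    · exact ht _ (Move.jumpSecond x y ⟨b, hb⟩ h (fun e => hab (by rw [h1, e])) (by
        rw [h1] at hlt; exact hlt))
    · exact ht _ (Move.jumpFirst x y ⟨a, ha⟩ h (fun e => hab (by rw [h1, ← e])) (by
        rw [h1] at hlt; exact hlt))

lemma Generic.exists_losing_step (hs : Generic s) {p : E × E} (hp : IsPair s p)
    (hl : ¬ Losing s p) (hex : ∃ q, Step s q p) : ∃ q, Step s q p ∧ Losing s q := by
  by_contra! h
  exact hl ((hs.losing_iff p).2 ⟨hp, hex, h⟩)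

lemma Generic.exists_move_isTarget_of_isTarget (hs : Generic s) {p q : Position s}
    (hp : IsTarget p) (hpq : Move s p q) (hq : ¬ IsTerminal (Move s) q) :
    ∃ r, Move s q r ∧ IsTarget r := by
  -- Alice's jump leads out of the losing pairs, and Bob can return to them.
  have key : ∀ (x y : s) (h : x ≠ y), ¬ Losing s (x.1, y.1) →
      ¬ IsTerminal (Move s) (Position.two x y h) →
      ∃ r, Move s (Position.two x y h) r ∧ IsTarget r := by
    intro x y h hl hnt
    have hpair : IsPair s (x.1, y.1) := ⟨x.2, y.2, fun e => h (Subtype.ext e)⟩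
    have hex : ∃ q, Step s q (x.1, y.1) := by
      simp only [IsTerminal, not_forall, not_not] at hnt
      obtain ⟨r, hr⟩ := hnt
      cases hr with
      | jumpFirst _ _ x' _ h' hd =>
        exact ⟨(x'.1, y.1), ⟨x'.2, y.2, fun e => h' (Subtype.ext e)⟩, Or.inr rfl, hd⟩
      | jumpSecond _ _ y' _ h' hd =>
        exact ⟨(x.1, y'.1), ⟨x.2, y'.2, fun e => h' (Subtype.ext e)⟩, Or.inl rfl, hd⟩
    obtain ⟨⟨a, b⟩, ⟨⟨ha, hb, hab⟩, h1 | h1, hlt⟩, hL⟩ := hs.exists_losing_step hpair hl hex <;>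
      simp only at ha hb hab h1 hlt
    · subst h1
      exact ⟨_, Move.jumpSecond x y ⟨b, hb⟩ h (fun e => hab (by rw [e])) hlt, hL⟩
    · subst h1
      exact ⟨_, Move.jumpFirst x y ⟨a, ha⟩ h (fun e => hab (by rw [← e])) hlt, hL⟩
  cases hpq with
  | placeFirst x => exact hp.elim
  | placeSecond x y h => exact hp.elim
  | jumpFirst x y x' h h' hd =>
    refine key x' y h' (((hs.losing_iff _).1 hp).2.2 (x'.1, y.1) ?_) hq
    exact ⟨⟨x'.2, y.2, fun e => h' (Subtype.ext e)⟩, Or.inr rfl, hd⟩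
  | jumpSecond x y y' h h' hd =>
    refine key x y' h' (((hs.losing_iff _).1 hp).2.2 (x.1, y'.1) ?_) hq
    exact ⟨⟨x.2, y'.2, fun e => h' (Subtype.ext e)⟩, Or.inl rfl, hd⟩

lemma exists_move_isTarget_of_zero (hcov : ∀ x ∈ s, ∃ y, Losing s (x, y)) {q : Position s}
    (hq : Move s Position.zero q) : ∃ r, Move s q r ∧ IsTarget r := by
  cases hq with
  | placeFirst x =>
    obtain ⟨y, hy⟩ := hcov x x.2
    exact ⟨_, Move.placeSecond x ⟨y, hy.isPair.2.1⟩ (fun e => hy.isPair.2.2 (by rw [e])), hy⟩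

/-- Bob, who always moves to a losing pair, wins if every point belongs to one. -/
theorem Generic.misereWinForBob (hs : Generic s) (hne : s.Nonempty)
    (hcov : ∀ x ∈ s, ∃ y, Losing s (x, y)) : MisereWinForBob s := by
  classical
  have hτ : ∀ p : Position s, ∃ q, (¬ IsTerminal (Move s) p → Move s p q) ∧
      ((∃ r, Move s p r ∧ IsTarget r) → Move s p q ∧ IsTarget q) := by
    intro p
    by_cases h : ∃ r, Move s p r ∧ IsTarget r
    · obtain ⟨r, hr⟩ := h
      exact ⟨r, fun _ => hr.1, fun _ => hr⟩
    · by_cases ht : IsTerminal (Move s) p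
      · exact ⟨p, fun h' => absurd ht h', fun h' => absurd h' h⟩
      · have ht' := ht
        simp only [IsTerminal, not_forall, not_not] at ht'
        obtain ⟨q, hq⟩ := ht'
        exact ⟨q, fun _ => hq, fun h' => absurd h' h⟩
  choose τ hτ1 hτ2 using hτ
  refine ⟨τ, hτ1, fun σ hσ => ?_⟩
  set f := play σ τ (Position.zero : Position s) with hf
  have hzero : ¬ IsTerminal (Move s) (Position.zero : Position s) := by
    obtain ⟨x, hx⟩ := hne
    exact fun ht => ht _ (Move.placeFirst ⟨x, hx⟩)
  have hstep : ∀ n, ¬ IsTerminal (Move s) (f n) → Move s (f n) (f (n + 1)) := by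
    intro n hn
    simp only [hf, play]
    split_ifs
    · exact hσ _ hn
    · exact hτ1 _ hn
  -- At even times Alice is to move, so that Bob wins if the play cannot end at such a time.
  have heven : ∀ k, (∀ m < 2 * k, ¬ IsTerminal (Move s) (f m)) →
      f (2 * k) = Position.zero ∨ IsTarget (f (2 * k)) := by
    intro k
    induction k with
    | zero => exact fun _ => Or.inl rfl
    | succ k ih =>
      intro hk
      have h0 := ih fun m hm => hk m (by omega)
      have hm := hstep (2 * k) (hk _ (by omega))
      have ht := hk (2 * k + 1) (by omega)
      have hex : ∃ r, Move s (f (2 * k + 1)) r ∧ IsTarget r := by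
        rcases h0 with h0 | h0
        · rw [h0] at hm
          exact exists_move_isTarget_of_zero hcov hm
        · exact hs.exists_move_isTarget_of_isTarget h0 hm ht
      right
      have hodd : ¬ Even (2 * k + 1) := by simp
      have : f (2 * (k + 1)) = τ (f (2 * k + 1)) := by
        show play σ τ _ (2 * k + 1 + 1) = _
        rw [play, if_neg hodd]
      rw [this]
      exact (hτ2 _ hex).2
  have hend : ∃ n, IsTerminal (Move s) (f n) := by
    by_contra! hno
    exact (wellFounded_iff_isEmpty_descending_chain.1 hs.wellFounded_move).false
      ⟨f, fun n => hstep n (hno n)⟩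
  refine ⟨Nat.find hend, ?_, Nat.find_spec hend, fun m hm => Nat.find_min hend hm⟩
  by_contra hodd
  obtain ⟨k, hk⟩ := (Nat.not_odd_iff_even.1 hodd)
  have hk2 : Nat.find hend = 2 * k := by omega
  have hterm := Nat.find_spec hend
  rw [hk2] at hterm
  rcases heven k fun m hm => Nat.find_min hend (by omega) with h | h
  · rw [h] at hterm
    exact hzero hterm
  · exact hs.not_isTerminal_of_isTarget h hterm

end Deterministic

/-! ### The first-moment bound for tuples of points of a Poisson process -/

section Grid

variable {d : ℕ}

/-- The index of the cell of mesh `1 / (m + 1)` that contains `x`. -/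
noncomputable def gridIndex (m : ℕ) (x : EuclideanSpace ℝ (Fin d)) : Fin d → ℤ :=
  fun i => ⌊(m + 1 : ℝ) * x i⌋

lemma measurable_gridIndex (m : ℕ) : Measurable (gridIndex (d := d) m) := by
  unfold gridIndex
  fun_prop

lemma dist_le_of_gridIndex_eq {m : ℕ} {x y : EuclideanSpace ℝ (Fin d)}
    (h : gridIndex m x = gridIndex m y) : dist x y ≤ Real.sqrt (d * (1 / (m + 1 : ℝ)) ^ 2) := by
  rw [EuclideanSpace.dist_eq]
  refine Real.sqrt_le_sqrt ?_
  have hi : ∀ i, dist (x i) (y i) ^ 2 ≤ (1 / (m + 1 : ℝ)) ^ 2 := by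
    intro i
    have hm : (0 : ℝ) < m + 1 := by positivity
    have h1 := Int.abs_sub_lt_one_of_floor_eq_floor (congrFun h i)
    rw [← mul_sub, abs_mul, abs_of_pos hm] at h1
    refine pow_le_pow_left₀ dist_nonneg ?_ 2
    rw [Real.dist_eq, le_div_iff₀ hm, mul_comm]
    exact h1.le
  calc ∑ i, dist (x i) (y i) ^ 2 ≤ ∑ _i : Fin d, (1 / (m + 1 : ℝ)) ^ 2 :=
        Finset.sum_le_sum fun i _ => hi i
    _ = d * (1 / (m + 1 : ℝ)) ^ 2 := by simp

lemma tendsto_grid_diam :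
    Filter.Tendsto (fun m : ℕ => Real.sqrt (d * (1 / (m + 1 : ℝ)) ^ 2)) Filter.atTop (nhds 0) := by
  have h := (tendsto_one_div_add_atTop_nhds_zero_nat (𝕜 := ℝ))
  have h2 := ((h.pow 2).const_mul (d : ℝ)).sqrt
  simpa using h2

lemma eventually_gridIndex_dist_lt {ε : ℝ} (hε : 0 < ε) :
    ∀ᶠ m : ℕ in Filter.atTop, ∀ x y : EuclideanSpace ℝ (Fin d),
      gridIndex m x = gridIndex m y → dist x y < ε := by
  filter_upwards [(tendsto_grid_diam (d := d)).eventually (gt_mem_nhds hε)] with m hm x y h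
  exact (dist_le_of_gridIndex_eq h).trans_lt hm

lemma volume_gridCell_lt_top (m : ℕ) (k : Fin d → ℤ) :
    volume (gridIndex (d := d) m ⁻¹' {k}) < ∞ := by
  refine Bornology.IsBounded.measure_lt_top (Metric.isBounded_iff.2
    ⟨Real.sqrt (d * (1 / (m + 1 : ℝ)) ^ 2), fun x hx y hy => ?_⟩)
  exact dist_le_of_gridIndex_eq (hx.trans hy.symm)

end Grid

lemma poissonMeasure_compl_zero_le (r : ℝ≥0) : poissonMeasure r {0}ᶜ ≤ r := by
  rw [prob_compl_eq_one_sub (measurableSet_singleton 0), poissonMeasure_singleton]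
  simp only [pow_zero, Nat.factorial_zero, Nat.cast_one, div_one, mul_one]
  rw [tsub_le_iff_left]
  calc (1 : ℝ≥0∞) = ENNReal.ofReal 1 := by simp
    _ ≤ ENNReal.ofReal (Real.exp (-r) + r) := by
        refine ENNReal.ofReal_le_ofReal ?_
        have := Real.add_one_le_exp (-(r : ℝ))
        linarith
    _ = ENNReal.ofReal (Real.exp (-r)) + r := by
        rw [← ENNReal.ofReal_coe_nnreal (p := r), ENNReal.ofReal_add (Real.exp_pos _).le r.coe_nonneg]

section Poisson

variable {Ω : Type*} [MeasurableSpace Ω] {μ : Measure Ω} {d : ℕ} {lam : ℝ≥0}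
  {L : Ω → Set (EuclideanSpace ℝ (Fin d))}

namespace IsPoissonProcess

lemma measure_count_preimage (hL : IsPoissonProcess μ lam L)
    {B : Set (EuclideanSpace ℝ (Fin d))} (hB : MeasurableSet B) (hB' : volume B < ∞)
    (S : Set ℕ∞) :
    μ ((fun ω => (L ω ∩ B).encard) ⁻¹' S) =
      poissonMeasure (lam * (volume B).toNNReal) ((fun n : ℕ => (n : ℕ∞)) ⁻¹' S) := by
  have hS : MeasurableSet S := S.to_countable.measurableSet
  rw [← Measure.map_apply (hL.measurable_count B hB hB') hS, hL.law_count B hB hB',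
    Measure.map_apply (by fun_prop) hS]

lemma measure_count_ne_zero_le (hL : IsPoissonProcess μ lam L)
    {B : Set (EuclideanSpace ℝ (Fin d))} (hB : MeasurableSet B) (hB' : volume B < ∞) :
    μ ((fun ω => (L ω ∩ B).encard) ⁻¹' {0}ᶜ) ≤ lam * volume B := by
  rw [hL.measure_count_preimage hB hB']
  have h : (fun n : ℕ => (n : ℕ∞)) ⁻¹' {0}ᶜ = {0}ᶜ := by ext; simp
  rw [h]
  refine (poissonMeasure_compl_zero_le _).trans_eq ?_
  rw [ENNReal.coe_mul, ENNReal.coe_toNNReal hB'.ne]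

/-- The first-moment bound on a grid: different cells contain independent numbers of points, each of
them is nonempty with probability at most `lam` times its volume, and the products of cells that are
contained in `T` have total volume at most that of `T`. -/
lemma measure_grid_le (hL : IsPoissonProcess μ lam L) (m k : ℕ)
    (T : Set (Fin k → EuclideanSpace ℝ (Fin d))) :
    μ {ω | ∃ c : Fin k → Fin d → ℤ, c.Injective ∧
        (∀ y : Fin k → EuclideanSpace ℝ (Fin d), (∀ i, gridIndex m (y i) = c i) → y ∈ T) ∧
        ∀ i, (L ω ∩ gridIndex m ⁻¹' {c i}).Nonempty} ≤ lam ^ k * volume T := by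
  set K : Set (Fin k → Fin d → ℤ) := {c | c.Injective ∧
    ∀ y : Fin k → EuclideanSpace ℝ (Fin d), (∀ i, gridIndex m (y i) = c i) → y ∈ T} with hK
  set cell : (Fin d → ℤ) → Set (EuclideanSpace ℝ (Fin d)) := fun k => gridIndex m ⁻¹' {k}
    with hcell
  have hcm : ∀ k, MeasurableSet (cell k) :=
    fun k => measurable_gridIndex m (measurableSet_singleton k)
  have hcv : ∀ k, volume (cell k) < ∞ := volume_gridCell_lt_top m
  have hsub : {ω | ∃ c : Fin k → Fin d → ℤ, c.Injective ∧
        (∀ y : Fin k → EuclideanSpace ℝ (Fin d), (∀ i, gridIndex m (y i) = c i) → y ∈ T) ∧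
        ∀ i, (L ω ∩ gridIndex m ⁻¹' {c i}).Nonempty} ⊆
      ⋃ c ∈ K, ⋂ i ∈ (Finset.univ : Finset (Fin k)),
        (fun ω => (L ω ∩ cell (c i)).encard) ⁻¹' {0}ᶜ := by
    rintro ω ⟨c, hinj, hT, hne⟩
    simp only [Set.mem_iUnion, Set.mem_iInter, Set.mem_preimage, Set.mem_compl_iff,
      Set.mem_singleton_iff, Set.encard_eq_zero]
    exact ⟨c, ⟨hinj, hT⟩, fun i _ => (hne i).ne_empty⟩
  have hprod : ∀ c ∈ K, μ (⋂ i ∈ (Finset.univ : Finset (Fin k)),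
      (fun ω => (L ω ∩ cell (c i)).encard) ⁻¹' {0}ᶜ) ≤
        lam ^ k * volume (Set.univ.pi fun i => cell (c i)) := by
    intro c hc
    have hind := hL.indep_count k (fun i => cell (c i)) (fun i => hcm _) (fun i => hcv _)
      (fun i j hij => by
        refine Set.disjoint_left.2 fun x hx hx' => hij (hc.1 ?_)
        exact (Set.mem_singleton_iff.1 hx).symm.trans hx')
    rw [hind.measure_inter_preimage_eq_mul Finset.univ
      (fun i _ => (Set.to_countable _).measurableSet), volume_pi_pi]
    calc ∏ i, μ ((fun ω => (L ω ∩ cell (c i)).encard) ⁻¹' {0}ᶜ)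
        ≤ ∏ i, (lam * volume (cell (c i))) :=
          Finset.prod_le_prod' fun i _ => hL.measure_count_ne_zero_le (hcm _) (hcv _)
      _ = lam ^ k * ∏ i, volume (cell (c i)) := by simp [Finset.prod_mul_distrib]
  have hKc : K.Countable := K.to_countable
  have hdisj : K.PairwiseDisjoint fun c => Set.univ.pi fun i => cell (c i) := by
    intro c _ c' _ hne
    refine Set.disjoint_left.2 fun x hx hx' => hne (funext fun i => ?_)
    exact (Set.mem_singleton_iff.1 (hx i trivial)).symm.trans (hx' i trivial)
  calc _ ≤ μ (⋃ c ∈ K, ⋂ i ∈ (Finset.univ : Finset (Fin k)),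
        (fun ω => (L ω ∩ cell (c i)).encard) ⁻¹' {0}ᶜ) := measure_mono hsub
    _ ≤ ∑' c : K, μ (⋂ i ∈ (Finset.univ : Finset (Fin k)),
        (fun ω => (L ω ∩ cell (c.1 i)).encard) ⁻¹' {0}ᶜ) := measure_biUnion_le _ hKc _
    _ ≤ ∑' c : K, lam ^ k * volume (Set.univ.pi fun i => cell (c.1 i)) :=
        ENNReal.tsum_le_tsum fun c => hprod c c.2
    _ = lam ^ k * volume (⋃ c ∈ K, Set.univ.pi fun i => cell (c i)) := by
        rw [ENNReal.tsum_mul_left, measure_biUnion hKc hdisj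
          fun c _ => MeasurableSet.univ_pi fun i => hcm _]
    _ ≤ lam ^ k * volume T := by
        gcongr
        refine Set.iUnion₂_subset fun c hc y hy => hc.2 y fun i => ?_
        exact hy i trivial

lemma measure_exists_tuple_le_of_isOpen (hL : IsPoissonProcess μ lam L) (k : ℕ)
    {T : Set (Fin k → EuclideanSpace ℝ (Fin d))} (hT : IsOpen T) :
    μ {ω | ∃ x : Fin k → EuclideanSpace ℝ (Fin d), x.Injective ∧ (∀ i, x i ∈ L ω) ∧ x ∈ T} ≤
      lam ^ k * volume T := by
  set H : ℕ → Set Ω := fun m => {ω | ∃ c : Fin k → Fin d → ℤ, c.Injective ∧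
        (∀ y : Fin k → EuclideanSpace ℝ (Fin d), (∀ i, gridIndex m (y i) = c i) → y ∈ T) ∧
        ∀ i, (L ω ∩ gridIndex m ⁻¹' {c i}).Nonempty} with hH
  -- On a fine grid the points of a given tuple lie in different cells, and the product of these
  -- cells is contained in the open set `T`.
  have hsub : {ω | ∃ x : Fin k → EuclideanSpace ℝ (Fin d),
      x.Injective ∧ (∀ i, x i ∈ L ω) ∧ x ∈ T} ⊆ ⋃ N : ℕ, ⋂ m ≥ N, H m := by
    rintro ω ⟨x, hinj, hxL, hxT⟩
    obtain ⟨ε, hε, hball⟩ := Metric.isOpen_iff.1 hT x hxT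
    have hsep : ∀ᶠ m : ℕ in Filter.atTop, ∀ i j, gridIndex m (x i) = gridIndex m (x j) → i = j := by
      refine Filter.eventually_all.2 fun i => Filter.eventually_all.2 fun j => ?_
      by_cases hij : i = j
      · exact Filter.Eventually.of_forall fun _ _ => hij
      · filter_upwards [eventually_gridIndex_dist_lt (d := d)
          (dist_pos.2 (hinj.ne hij))] with m hm h
        exact absurd (hm _ _ h) (lt_irrefl _)
    obtain ⟨N, hN⟩ := Filter.eventually_atTop.1
      (hsep.and (eventually_gridIndex_dist_lt (d := d) hε))
    refine Set.mem_iUnion.2 ⟨N, Set.mem_iInter₂.2 fun m hm => ?_⟩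
    refine ⟨fun i => gridIndex m (x i), fun i j h => (hN m hm).1 i j h, fun y hy => hball ?_,
      fun i => ⟨x i, hxL i, rfl⟩⟩
    rw [Metric.mem_ball, dist_pi_lt_iff hε]
    exact fun i => (hN m hm).2 _ _ (hy i)
  have hmono : Monotone fun N : ℕ => ⋂ m ≥ N, H m := by
    intro N N' h
    exact Set.biInter_subset_biInter_left fun m hm => le_trans h hm
  refine (measure_mono hsub).trans ?_
  rw [hmono.measure_iUnion]
  refine iSup_le fun N => (measure_mono (Set.biInter_subset_of_mem (le_refl N))).trans ?_
  exact hL.measure_grid_le N k T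

/-- The probability that some `k`-tuple of distinct points of the process lies in `T` is at most the
expected number of such tuples. -/
theorem measure_exists_tuple_le (hL : IsPoissonProcess μ lam L) (hlam : 0 < lam) (k : ℕ)
    (T : Set (Fin k → EuclideanSpace ℝ (Fin d))) :
    μ {ω | ∃ x : Fin k → EuclideanSpace ℝ (Fin d), x.Injective ∧ (∀ i, x i ∈ L ω) ∧ x ∈ T} ≤
      lam ^ k * volume T := by
  have : (volume : Measure (Fin k → EuclideanSpace ℝ (Fin d))).Regular :=
    Measure.Regular.of_sigmaCompactSpace_of_isLocallyFiniteMeasure _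
  have h0 : (lam : ℝ≥0∞) ^ k ≠ 0 := pow_ne_zero _ (ENNReal.coe_ne_zero.2 hlam.ne')
  have h1 : (lam : ℝ≥0∞) ^ k ≠ ∞ := ENNReal.pow_ne_top ENNReal.coe_ne_top
  rw [T.measure_eq_iInf_isOpen volume]
  simp only [ENNReal.mul_iInf_of_ne h0 h1]
  refine le_iInf fun U => le_iInf fun hTU => le_iInf fun hU => ?_
  refine (measure_mono ?_).trans (hL.measure_exists_tuple_le_of_isOpen k hU)
  rintro ω ⟨x, hinj, hxL, hxT⟩
  exact ⟨x, hinj, hxL, hTU hxT⟩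

end IsPoissonProcess

end Poisson

/-! ### Absence of infinite descending sequences of jumps -/

section Descending

variable {E : Type*} [MetricSpace E]

/-- The graph on `s` whose edges join the points at a distance strictly between `a` and `b`. -/
def annulusGraph (s : Set E) (a b : ℝ) : SimpleGraph E where
  Adj x y := x ≠ y ∧ x ∈ s ∧ y ∈ s ∧ a < dist x y ∧ dist x y < b
  symm := ⟨fun x y h => ⟨h.1.symm, h.2.2.1, h.2.1, by rw [dist_comm]; exact h.2.2.2⟩⟩
  loopless := ⟨fun _ h => h.1 rfl⟩

/-- The tuples of `n + 1` points that are consecutively at distances strictly between `a` and `b`. -/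
def annulusPaths (E : Type*) [MetricSpace E] (a b : ℝ) (n : ℕ) : Set (Fin (n + 1) → E) :=
  {x | ∀ i : Fin n, a < dist (x i.castSucc) (x i.succ) ∧ dist (x i.castSucc) (x i.succ) < b}

variable {s : Set E} {a b : ℝ}

lemma finite_walk_endpoints (hs : ∀ x r, (s ∩ Metric.closedBall x r).Finite) (n : ℕ) :
    ∀ x, {v | ∃ p : (annulusGraph s a b).Walk x v, p.length ≤ n}.Finite := by
  induction n with
  | zero =>
    intro x
    refine (Set.finite_singleton x).subset ?_
    rintro v ⟨p, hp⟩
    exact (SimpleGraph.Walk.eq_of_length_eq_zero (Nat.le_zero.1 hp)).symm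
  | succ n ih =>
    intro x
    refine ((Set.finite_singleton x).union ((hs x b).biUnion fun w _ => ih w)).subset ?_
    rintro v ⟨p, hp⟩
    cases p with
    | nil => exact Or.inl rfl
    | @cons _ w _ h p =>
      refine Or.inr (Set.mem_biUnion (x := w) ⟨h.2.2.1, ?_⟩ ⟨p, ?_⟩)
      · rw [Metric.mem_closedBall, dist_comm]
        exact h.2.2.2.2.le
      · simpa using hp

/-- If simple paths from `x` have bounded length then the component of `x` is finite. -/
lemma finite_reachable (hs : ∀ x r, (s ∩ Metric.closedBall x r).Finite) {x : E} {n : ℕ}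
    (hn : ¬ ∃ y : Fin (n + 1) → E, y.Injective ∧ (∀ i, y i ∈ s) ∧ y 0 = x ∧
      y ∈ annulusPaths E a b n) :
    {v | (annulusGraph s a b).Reachable x v}.Finite := by
  refine (finite_walk_endpoints (a := a) (b := b) hs n x).subset fun v hv => ?_
  obtain ⟨p, hp⟩ := SimpleGraph.Reachable.exists_isPath hv
  refine ⟨p, ?_⟩
  by_contra! hlt
  refine hn ⟨fun i => p.getVert i, fun i j hij => ?_, fun i => ?_, by simp, fun i => ?_⟩
  · have hi : (i : ℕ) ≤ p.length := by omega
    have hj : (j : ℕ) ≤ p.length := by omega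
    exact Fin.ext (hp.getVert_injOn hi hj hij)
  · by_cases hi : (i : ℕ) < p.length
    · exact (p.adj_getVert_succ hi).2.1
    · omega
  · have hi : (i : ℕ) < p.length := by omega
    exact (p.adj_getVert_succ hi).2.2.2

/-- The lengths along an infinite sequence of jumps converge to a limit, hence from some time on
belong to any given interval around it. All pairs visited from then on lie in a single component of
the graph of edges with such lengths, and a finite component contains only finitely many pairs. -/
lemma wellFounded_step (hs : ∀ x r, (s ∩ Metric.closedBall x r).Finite)
    (h : ∀ l : ℝ, ∃ a b, a < l ∧ l < b ∧ ∀ x ∈ s, ∃ n, ¬ ∃ y : Fin (n + 1) → E,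
      y.Injective ∧ (∀ i, y i ∈ s) ∧ y 0 = x ∧ y ∈ annulusPaths E a b n) :
    WellFounded (Step s) := by
  rw [wellFounded_iff_isEmpty_descending_chain]
  refine ⟨fun ⟨p, hp⟩ => ?_⟩
  set len : ℕ → ℝ := fun n => dist (p n).1 (p n).2 with hlen
  have hanti : StrictAnti len := strictAnti_nat_of_succ_lt fun n => (hp n).2.2
  have hbdd : BddBelow (Set.range len) := ⟨0, by rintro _ ⟨n, rfl⟩; exact dist_nonneg⟩
  have hlim := tendsto_atTop_ciInf hanti.antitone hbdd
  obtain ⟨a, b, ha, hb, hpath⟩ := h (⨅ n, len n)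
  obtain ⟨N, hN⟩ := Filter.eventually_atTop.1 (hlim.eventually (gt_mem_nhds hb))
  have hadj : ∀ n ≥ N + 1, (annulusGraph s a b).Adj (p n).1 (p n).2 := by
    intro n hn
    obtain ⟨m, rfl⟩ : ∃ m, n = m + 1 := ⟨n - 1, by omega⟩
    have hpair := (hp m).1
    exact ⟨hpair.2.2, hpair.1, hpair.2.1, ha.trans_le (ciInf_le hbdd _), hN _ (by omega)⟩
  have hx : (p (N + 1)).1 ∈ s := (hp N).1.1
  obtain ⟨n, hn⟩ := hpath _ hx
  have hfin := finite_reachable hs hn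
  have hreach : ∀ k, (annulusGraph s a b).Reachable (p (N + 1)).1 (p (N + 1 + k)).1 := by
    intro k
    induction k with
    | zero => exact SimpleGraph.Reachable.refl _
    | succ k ih =>
      rcases (hp (N + 1 + k)).2.1 with h1 | h1
      · rw [← add_assoc, h1]; exact ih
      · refine (ih.trans (hadj (N + 1 + k) (by omega)).reachable).trans ?_
        rw [← h1]
        exact (hadj (N + 1 + k + 1) (by omega)).symm.reachable
  have hmem : ∀ k, p (N + 1 + k) ∈ {v | (annulusGraph s a b).Reachable (p (N + 1)).1 v} ×ˢ
      {v | (annulusGraph s a b).Reachable (p (N + 1)).1 v} := fun k =>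
    ⟨hreach k, (hreach k).trans (hadj (N + 1 + k) (by omega)).reachable⟩
  have hinj : Function.Injective fun k => p (N + 1 + k) := by
    intro k k' hkk
    have : len (N + 1 + k) = len (N + 1 + k') := by
      simp only [hlen]
      rw [show p (N + 1 + k) = p (N + 1 + k') from hkk]
    have := hanti.injective this
    omega
  exact Set.infinite_of_injective_forall_mem hinj hmem (hfin.prod hfin)

end Descending

section Volume

variable {d : ℕ}

local notation "𝔼" => EuclideanSpace ℝ (Fin d)

/-- Fubini's theorem for the last coordinate, as an inequality. -/
lemma volume_le_of_sections {n : ℕ} {S : Set (Fin n → 𝔼)} {T : Set (Fin (n + 1) → 𝔼)}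
    (hS : MeasurableSet S) (hT : MeasurableSet T) (c : ℝ≥0∞)
    (hTS : ∀ y z, (Fin.snoc y z : Fin (n + 1) → 𝔼) ∈ T → y ∈ S)
    (hsec : ∀ y ∈ S, volume {z : 𝔼 | (Fin.snoc y z : Fin (n + 1) → 𝔼) ∈ T} ≤ c) :
    volume T ≤ c * volume S := by
  have hmp := (volume_preserving_piFinSuccAbove (fun _ : Fin (n + 1) => 𝔼) (Fin.last n)).symm
  have hsnoc : ∀ q : 𝔼 × (Fin n → 𝔼),
      (MeasurableEquiv.piFinSuccAbove (fun _ : Fin (n + 1) => 𝔼) (Fin.last n)).symm q =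
        (Fin.snoc q.2 q.1 : Fin (n + 1) → 𝔼) := by
    intro q
    rw [← Fin.insertNth_last']
    rfl
  rw [← hmp.measure_preimage hT.nullMeasurableSet, Measure.volume_eq_prod,
    Measure.prod_apply_symm (MeasurableEquiv.measurable _ hT)]
  calc _ ≤ ∫⁻ y : Fin n → 𝔼, S.indicator (fun _ => c) y := by
        refine lintegral_mono fun y => ?_
        have hset : (fun z : 𝔼 => (z, y)) ⁻¹'
            ((MeasurableEquiv.piFinSuccAbove (fun _ : Fin (n + 1) => 𝔼) (Fin.last n)).symm ⁻¹' T) =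
            {z : 𝔼 | (Fin.snoc y z : Fin (n + 1) → 𝔼) ∈ T} := by
          ext z
          simp only [Set.mem_preimage, Set.mem_ofPred_eq]
          rw [hsnoc]
        rw [hset]
        by_cases hy : y ∈ S
        · rw [Set.indicator_of_mem hy]
          exact hsec y hy
        · rw [Set.indicator_of_notMem hy]
          have : {z : 𝔼 | (Fin.snoc y z : Fin (n + 1) → 𝔼) ∈ T} = ∅ :=
            Set.eq_empty_of_forall_notMem fun z hz => hy (hTS y z hz)
          rw [this, measure_empty]
    _ = c * volume S := by rw [lintegral_indicator_const hS]

lemma volume_annulus (p : 𝔼) (a b : ℝ) :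
    volume {z : 𝔼 | a < dist p z ∧ dist p z < b} =
      volume {z : 𝔼 | a < ‖z‖ ∧ ‖z‖ < b} := by
  rw [← measure_preimage_add_right volume (-p) {z : 𝔼 | a < ‖z‖ ∧ ‖z‖ < b}]
  congr 1
  ext z
  simp only [Set.mem_ofPred_eq, Set.mem_preimage, dist_eq_norm, norm_sub_rev p z]
  rw [← sub_eq_add_neg]

lemma isOpen_annulusPaths (a b : ℝ) (n : ℕ) : IsOpen (annulusPaths 𝔼 a b n) := by
  have : annulusPaths 𝔼 a b n =
      ⋂ i : Fin n, {x | a < dist (x i.castSucc) (x i.succ) ∧ dist (x i.castSucc) (x i.succ) < b} := by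
    ext x; simp [annulusPaths]
  rw [this]
  refine isOpen_iInter_of_finite fun i => ?_
  have hc : Continuous fun x : Fin (n + 1) → 𝔼 => dist (x i.castSucc) (x i.succ) := by fun_prop
  exact (isOpen_lt continuous_const hc).inter (isOpen_lt hc continuous_const)

lemma volume_annulusPaths_le (a b R : ℝ) (n : ℕ) :
    volume ({x | x 0 ∈ Metric.ball (0 : 𝔼) R} ∩ annulusPaths 𝔼 a b n) ≤
      volume {z : 𝔼 | a < ‖z‖ ∧ ‖z‖ < b} ^ n * volume (Metric.ball (0 : 𝔼) R) := by
  have hmeas : ∀ n, MeasurableSet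
      ({x : Fin (n + 1) → 𝔼 | x 0 ∈ Metric.ball (0 : 𝔼) R} ∩ annulusPaths 𝔼 a b n) := fun n =>
    ((measurable_pi_apply 0) measurableSet_ball).inter (isOpen_annulusPaths a b n).measurableSet
  induction n with
  | zero =>
    refine (volume_le_of_sections (S := Set.univ) MeasurableSet.univ (hmeas 0)
      (volume (Metric.ball (0 : 𝔼) R)) (fun _ _ _ => trivial) fun y _ => ?_).trans ?_
    · refine measure_mono fun z hz => ?_
      exact hz.1
    · simp [volume_pi]
  | succ n ih =>
    refine (volume_le_of_sections (hmeas n) (hmeas (n + 1))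
      (volume {z : 𝔼 | a < ‖z‖ ∧ ‖z‖ < b}) ?_ ?_).trans ?_
    · rintro y z ⟨h0, hp⟩
      refine ⟨?_, fun i => ?_⟩
      · have : (0 : Fin (n + 2)) = (0 : Fin (n + 1)).castSucc := rfl
        rw [Set.mem_ofPred_eq, this, Fin.snoc_castSucc] at h0
        exact h0
      · have := hp i.castSucc
        rwa [Fin.snoc_castSucc, Fin.succ_castSucc, Fin.snoc_castSucc] at this
    · intro y _
      rw [← volume_annulus (y (Fin.last n))]
      refine measure_mono fun z hz => ?_
      have := hz.2 (Fin.last n)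
      rwa [Fin.snoc_castSucc, Fin.succ_last, Fin.snoc_last] at this
    · rw [pow_succ', mul_assoc]
      gcongr

lemma volume_isosceles (hd : 1 ≤ d) :
    volume {x : Fin 3 → 𝔼 | dist (x 0) (x 1) = dist (x 0) (x 2)} = 0 := by
  have : Nonempty (Fin d) := ⟨⟨0, hd⟩⟩
  rw [← nonpos_iff_eq_zero]
  refine (volume_le_of_sections (S := Set.univ) MeasurableSet.univ ?_ 0
    (fun _ _ _ => trivial) fun y _ => ?_).trans (by simp)
  · exact measurableSet_eq_fun (by fun_prop) (by fun_prop)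
  · rw [← Measure.addHaar_sphere volume (y 0) (dist (y 0) (y 1))]
    refine measure_mono fun z hz => ?_
    have h0 : (0 : Fin 3) = (0 : Fin 2).castSucc := rfl
    have h1 : (1 : Fin 3) = (1 : Fin 2).castSucc := rfl
    have h2 : (2 : Fin 3) = Fin.last 2 := rfl
    rw [Set.mem_ofPred_eq, Set.mem_ofPred_eq, h0, h1, h2, Fin.snoc_castSucc, Fin.snoc_castSucc,
      Fin.snoc_last] at hz
    rw [Metric.mem_sphere, dist_comm z]
    exact hz.symm

/-- Spheres are null sets, so thin annuli have small volume. -/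
lemma exists_annulus_volume_le (hd : 1 ≤ d) (l : ℝ) {c : ℝ≥0∞} (hc : 0 < c) :
    ∃ a b : ℚ, (a : ℝ) < l ∧ l < b ∧
      volume {z : 𝔼 | (a : ℝ) < ‖z‖ ∧ ‖z‖ < b} ≤ c := by
  have : Nonempty (Fin d) := ⟨⟨0, hd⟩⟩
  set A : ℕ → Set 𝔼 := fun m => {z | l - 1 / (m + 1 : ℝ) < ‖z‖ ∧ ‖z‖ < l + 1 / (m + 1 : ℝ)} with hA
  have hmeas : ∀ m, MeasurableSet (A m) := fun m =>
    (measurableSet_lt measurable_const measurable_norm).inter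
      (measurableSet_lt measurable_norm measurable_const)
  have hanti : Antitone A := by
    intro m m' hmm z hz
    have : 1 / ((m' : ℝ) + 1) ≤ 1 / ((m : ℝ) + 1) := by gcongr
    exact ⟨by linarith [hz.1], by linarith [hz.2]⟩
  have hfin : volume (A 0) ≠ ∞ := by
    refine ((measure_mono fun z hz => ?_).trans_lt
      (Metric.isBounded_ball (x := (0 : 𝔼)) (r := l + 1)).measure_lt_top).ne
    rw [mem_ball_zero_iff]
    simpa using hz.2
  have hInter : volume (⋂ m, A m) = 0 := by
    rw [← nonpos_iff_eq_zero, ← Measure.addHaar_sphere volume (0 : 𝔼) l]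
    refine measure_mono fun z hz => ?_
    rw [mem_sphere_zero_iff_norm]
    have hz : ∀ m, z ∈ A m := Set.mem_iInter.1 hz
    by_contra hne
    obtain ⟨m, hm⟩ := exists_nat_one_div_lt (abs_pos.2 (sub_ne_zero.2 hne))
    have := hz m
    have h2 : |‖z‖ - l| < 1 / ((m : ℝ) + 1) := by
      rw [abs_lt]
      exact ⟨by linarith [this.1], by linarith [this.2]⟩
    linarith
  have hlim := tendsto_measure_iInter_atTop (μ := volume) (s := A)
    (fun m => (hmeas m).nullMeasurableSet) hanti ⟨0, hfin⟩
  rw [hInter] at hlim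
  obtain ⟨m, hm⟩ := (hlim.eventually (gt_mem_nhds hc)).exists
  have hpos : (0 : ℝ) < 1 / (m + 1 : ℝ) := by positivity
  obtain ⟨a, ha1, ha2⟩ := exists_rat_btwn (show l - 1 / (m + 1 : ℝ) < l by linarith)
  obtain ⟨b, hb1, hb2⟩ := exists_rat_btwn (show l < l + 1 / (m + 1 : ℝ) by linarith)
  refine ⟨a, b, ha2, hb1, (measure_mono fun z hz => ?_).trans hm.le⟩
  exact ⟨ha1.trans hz.1, hz.2.trans hb2⟩

end Volume

/-! ### Almost sure properties of a Poisson process -/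

namespace IsPoissonProcess

variable {Ω : Type*} [MeasurableSpace Ω] {μ : Measure Ω} {d : ℕ} {lam : ℝ≥0}
  {L : Ω → Set (EuclideanSpace ℝ (Fin d))}

lemma ae_locallyFinite (hL : IsPoissonProcess μ lam L) :
    ∀ᵐ ω ∂μ, ∀ x r, (L ω ∩ Metric.closedBall x r).Finite := by
  have h : ∀ n : ℕ, ∀ᵐ ω ∂μ, (L ω ∩ Metric.closedBall 0 n).Finite := by
    intro n
    have h1 := hL.measure_count_preimage (B := Metric.closedBall 0 n) measurableSet_closedBall
      Metric.isBounded_closedBall.measure_lt_top {⊤}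
    have h2 : (fun n : ℕ => (n : ℕ∞)) ⁻¹' {⊤} = ∅ := by ext; simp
    rw [h2, measure_empty] at h1
    filter_upwards [measure_eq_zero_iff_ae_notMem.1 h1] with ω hω
    exact Set.encard_ne_top_iff.1 hω
  filter_upwards [ae_all_iff.2 h] with ω hω x r
  obtain ⟨n, hn⟩ := exists_nat_ge (r + dist x 0)
  refine (hω n).subset (Set.inter_subset_inter_right _ ?_)
  exact Metric.closedBall_subset_closedBall' hn

lemma ae_not_isosceles (hL : IsPoissonProcess μ lam L) (hd : 1 ≤ d) (hlam : 0 < lam) :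
    ∀ᵐ ω ∂μ, ∀ x ∈ L ω, ∀ y ∈ L ω, ∀ z ∈ L ω, y ≠ z → dist x y ≠ dist x z := by
  have h := hL.measure_exists_tuple_le hlam 3 {x | dist (x 0) (x 1) = dist (x 0) (x 2)}
  rw [volume_isosceles hd, mul_zero, nonpos_iff_eq_zero] at h
  filter_upwards [measure_eq_zero_iff_ae_notMem.1 h] with ω hω x hx y hy z hz hyz heq
  -- The bound for tuples requires distinct points; a degenerate triple forces `y = z`.
  have hxy : x ≠ y := by
    rintro rfl
    exact hyz (dist_eq_zero.1 (heq.symm.trans (dist_self _)))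
  have hxz : x ≠ z := by
    rintro rfl
    exact hxy (dist_eq_zero.1 (heq.trans (dist_self _)))
  refine hω ⟨![x, y, z], ?_, ?_, heq⟩
  · intro i j
    fin_cases i <;> fin_cases j <;> simp [hxy, hxz, hyz, hxy.symm, hxz.symm, hyz.symm]
  · intro i
    fin_cases i <;> simp [hx, hy, hz]

/-- The graph of edges with lengths in a short interval is subcritical: the expected number of its
simple paths of length `n` that start in a given ball decays exponentially in `n`. -/
lemma ae_exists_not_path (hL : IsPoissonProcess μ lam L) (hlam : 0 < lam) {a b : ℝ}
    (hab : volume {z : EuclideanSpace ℝ (Fin d) | a < ‖z‖ ∧ ‖z‖ < b} ≤ (2 * lam : ℝ≥0∞)⁻¹)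
    (R : ℝ) :
    ∀ᵐ ω ∂μ, ∃ n, ¬ ∃ y : Fin (n + 1) → EuclideanSpace ℝ (Fin d), y.Injective ∧
      (∀ i, y i ∈ L ω) ∧ y ∈ {x | x 0 ∈ Metric.ball 0 R} ∩ annulusPaths _ a b n := by
  set P : ℕ → Set Ω := fun n => {ω | ∃ y : Fin (n + 1) → EuclideanSpace ℝ (Fin d), y.Injective ∧
      (∀ i, y i ∈ L ω) ∧ y ∈ {x | x 0 ∈ Metric.ball 0 R} ∩ annulusPaths _ a b n} with hP
  set C : ℝ≥0∞ := lam * volume (Metric.ball (0 : EuclideanSpace ℝ (Fin d)) R) with hC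
  have hCtop : C ≠ ∞ := ENNReal.mul_ne_top ENNReal.coe_ne_top
    Metric.isBounded_ball.measure_lt_top.ne
  have hlam0 : (lam : ℝ≥0∞) ≠ 0 := ENNReal.coe_ne_zero.2 hlam.ne'
  have hbound : ∀ n, μ (P n) ≤ C * 2⁻¹ ^ n := by
    intro n
    refine (hL.measure_exists_tuple_le hlam (n + 1) _).trans ?_
    calc (lam : ℝ≥0∞) ^ (n + 1) * volume ({x : Fin (n + 1) → EuclideanSpace ℝ (Fin d) |
          x 0 ∈ Metric.ball 0 R} ∩ annulusPaths _ a b n)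
        ≤ lam ^ (n + 1) * ((2 * lam : ℝ≥0∞)⁻¹ ^ n *
          volume (Metric.ball (0 : EuclideanSpace ℝ (Fin d)) R)) := by
          gcongr
          exact (volume_annulusPaths_le a b R n).trans (by gcongr)
      _ = C * (lam * (2 * lam : ℝ≥0∞)⁻¹) ^ n := by
          rw [hC, pow_succ, mul_pow]
          ring
      _ = C * 2⁻¹ ^ n := by
          rw [ENNReal.mul_inv (Or.inl two_ne_zero) (Or.inl ENNReal.ofNat_ne_top), mul_left_comm,
            ENNReal.mul_inv_cancel hlam0 ENNReal.coe_ne_top, mul_one]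
  have hlim : Filter.Tendsto (fun n : ℕ => C * (2⁻¹ : ℝ≥0∞) ^ n) Filter.atTop (nhds 0) := by
    have := ENNReal.Tendsto.const_mul (a := C)
      (ENNReal.tendsto_pow_atTop_nhds_zero_of_lt_one (ENNReal.inv_lt_one.2 ENNReal.one_lt_two))
      (Or.inr hCtop)
    simpa using this
  have hzero : μ (⋂ n, P n) = 0 := by
    rw [← nonpos_iff_eq_zero]
    exact ge_of_tendsto' hlim fun n => (measure_mono (Set.iInter_subset P n)).trans (hbound n)
  filter_upwards [measure_eq_zero_iff_ae_notMem.1 hzero] with ω hω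
  exact not_forall.1 fun h => hω (Set.mem_iInter.2 h)

lemma ae_wellFounded_step (hL : IsPoissonProcess μ lam L) (hd : 1 ≤ d) (hlam : 0 < lam) :
    ∀ᵐ ω ∂μ, WellFounded (Step (L ω)) := by
  have hpath : ∀ᵐ ω ∂μ, ∀ a b : ℚ, ∀ R : ℕ,
      volume {z : EuclideanSpace ℝ (Fin d) | (a : ℝ) < ‖z‖ ∧ ‖z‖ < b} ≤ (2 * lam : ℝ≥0∞)⁻¹ →
      ∃ n, ¬ ∃ y : Fin (n + 1) → EuclideanSpace ℝ (Fin d), y.Injective ∧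
        (∀ i, y i ∈ L ω) ∧ y ∈ {x | x 0 ∈ Metric.ball 0 (R : ℝ)} ∩ annulusPaths _ a b n := by
    refine ae_all_iff.2 fun a => ae_all_iff.2 fun b => ae_all_iff.2 fun R => ?_
    by_cases hab : volume {z : EuclideanSpace ℝ (Fin d) | (a : ℝ) < ‖z‖ ∧ ‖z‖ < b} ≤
        (2 * lam : ℝ≥0∞)⁻¹
    · filter_upwards [hL.ae_exists_not_path hlam hab R] with ω hω _ using hω
    · exact Filter.Eventually.of_forall fun _ h => absurd h hab
  filter_upwards [hpath, hL.ae_locallyFinite] with ω hω hfin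
  refine wellFounded_step hfin fun l => ?_
  have hc : (0 : ℝ≥0∞) < (2 * lam : ℝ≥0∞)⁻¹ :=
    ENNReal.inv_pos.2 (ENNReal.mul_ne_top ENNReal.ofNat_ne_top ENNReal.coe_ne_top)
  obtain ⟨a, b, ha, hb, hab⟩ := exists_annulus_volume_le hd l hc
  refine ⟨a, b, ha, hb, fun x _ => ?_⟩
  obtain ⟨R, hR⟩ := exists_nat_gt ‖x‖
  obtain ⟨n, hn⟩ := hω a b R hab
  refine ⟨n, fun ⟨y, hy, hyL, hy0, hyp⟩ => hn ⟨y, hy, hyL, ?_, hyp⟩⟩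
  rw [Set.mem_ofPred_eq, hy0, mem_ball_zero_iff]
  exact hR

lemma ae_generic (hL : IsPoissonProcess μ lam L) (hd : 1 ≤ d) (hlam : 0 < lam) :
    ∀ᵐ ω ∂μ, Generic (L ω) := by
  filter_upwards [hL.ae_locallyFinite, hL.ae_not_isosceles hd hlam,
    hL.ae_wellFounded_step hd hlam] with ω h1 h2 h3 using ⟨h1, h2, h3⟩

/-- Large balls are empty with exponentially small probability. -/
lemma ae_nonempty (hL : IsPoissonProcess μ lam L) (hd : 1 ≤ d) (hlam : 0 < lam) :
    ∀ᵐ ω ∂μ, (L ω).Nonempty := by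
  have : Nonempty (Fin d) := ⟨⟨0, hd⟩⟩
  set v : ℕ → ℝ≥0∞ := fun n => volume (Metric.closedBall (0 : EuclideanSpace ℝ (Fin d)) n) with hv
  have hvtop : ∀ n, v n < ∞ := fun n => Metric.isBounded_closedBall.measure_lt_top
  have hle : ∀ n, μ {ω | L ω = ∅} ≤ ENNReal.ofReal (Real.exp (-(lam * (v n).toNNReal))) := by
    intro n
    have h1 := hL.measure_count_preimage (B := Metric.closedBall 0 n) measurableSet_closedBall
      (hvtop n) {0}
    have h2 : (fun n : ℕ => (n : ℕ∞)) ⁻¹' {0} = {0} := by ext; simp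
    rw [h2, poissonMeasure_singleton] at h1
    refine (measure_mono fun ω hω => ?_).trans (h1.trans_le ?_)
    · have hω : L ω = ∅ := hω
      simp [hω]
    · simp [hv]
  have hlimv : Filter.Tendsto v Filter.atTop (nhds ∞) := by
    have hmono : Monotone fun n : ℕ => Metric.closedBall (0 : EuclideanSpace ℝ (Fin d)) n :=
      fun m n h => Metric.closedBall_subset_closedBall (by exact_mod_cast h)
    have := tendsto_measure_iUnion_atTop (μ := volume) hmono
    rwa [Metric.iUnion_closedBall_nat, measure_univ_of_isAddLeftInvariant] at this
  have hlim : Filter.Tendsto (fun n => ENNReal.ofReal (Real.exp (-(lam * (v n).toNNReal))))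
      Filter.atTop (nhds 0) := by
    rw [← ENNReal.ofReal_zero]
    refine ENNReal.tendsto_ofReal (Real.tendsto_exp_neg_atTop_nhds_zero.comp ?_)
    refine Filter.Tendsto.const_mul_atTop (by exact_mod_cast hlam) ?_
    rw [Filter.tendsto_atTop]
    intro r
    filter_upwards [hlimv.eventually (lt_mem_nhds (ENNReal.ofReal_lt_top (r := r)))] with n hn
    exact (ENNReal.ofReal_le_iff_le_toReal (hvtop n).ne).1 hn.le
  have hzero : μ {ω | L ω = ∅} = 0 := by
    rw [← nonpos_iff_eq_zero]
    exact ge_of_tendsto' hlim hle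
  filter_upwards [measure_eq_zero_iff_ae_notMem.1 hzero] with ω hω
  exact Set.nonempty_iff_ne_empty.2 hω

end IsPoissonProcess

/-! ### The law of a Poisson process -/

/-- The Borel sets of finite volume. -/
abbrev FiniteVolumeSet (d : ℕ) : Type :=
  {B : Set (EuclideanSpace ℝ (Fin d)) // MeasurableSet B ∧ volume B < ∞}

/-- The numbers of points of `s` in all Borel sets of finite volume. -/
noncomputable def counts {d : ℕ} (s : Set (EuclideanSpace ℝ (Fin d))) (B : FiniteVolumeSet d) :
    ℕ∞ :=
  (s ∩ B.1).encard

section Atoms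

variable {d : ℕ} (I : Finset (FiniteVolumeSet d))

/-- The atoms of the algebra generated by finitely many sets, except the one outside all of them. -/
def atom (J : {J : Finset I // J.Nonempty}) : Set (EuclideanSpace ℝ (Fin d)) :=
  {x | ∀ B : I, x ∈ B.1.1 ↔ B ∈ J.1}

lemma measurableSet_atom (J : {J : Finset I // J.Nonempty}) : MeasurableSet (atom I J) := by
  have : atom I J = ⋂ B : I, {x | x ∈ B.1.1 ↔ B ∈ J.1} := by ext; simp [atom]
  rw [this]
  refine MeasurableSet.iInter fun B => ?_
  by_cases h : B ∈ J.1
  · simp only [h, iff_true]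
    exact B.1.2.1
  · simp only [h, iff_false]
    exact B.1.2.1.compl

lemma volume_atom_lt_top (J : {J : Finset I // J.Nonempty}) : volume (atom I J) < ∞ := by
  obtain ⟨B, hB⟩ := J.2
  exact (measure_mono fun x hx => (hx B).2 hB).trans_lt B.1.2.2

lemma disjoint_atom {J J' : {J : Finset I // J.Nonempty}} (h : J ≠ J') :
    Disjoint (atom I J) (atom I J') := by
  refine Set.disjoint_left.2 fun x hx hx' => h (Subtype.ext (Finset.ext fun B => ?_))
  rw [← hx B, ← hx' B]

open Classical in
lemma counts_eq_sum_atom (s : Set (EuclideanSpace ℝ (Fin d))) (B : I) :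
    counts s B.1 = ∑ J : {J : Finset I // J.Nonempty},
      if B ∈ J.1 then (s ∩ atom I J).encard else 0 := by
  have hset : s ∩ B.1.1 = ⋃ J : {J : Finset I // J.Nonempty},
      if B ∈ J.1 then s ∩ atom I J else ∅ := by
    ext x
    simp only [Set.mem_iUnion]
    constructor
    · rintro ⟨hx, hxB⟩
      have hBJ : B ∈ Finset.univ.filter fun B' : I => x ∈ B'.1.1 := by simpa using hxB
      refine ⟨⟨Finset.univ.filter fun B' : I => x ∈ B'.1.1, ⟨B, hBJ⟩⟩, ?_⟩
      rw [if_pos hBJ]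
      exact ⟨hx, fun B' => by simp⟩
    · rintro ⟨J, hJ⟩
      split_ifs at hJ with h
      · exact ⟨hJ.1, (hJ.2 B).2 h⟩
      · exact hJ.elim
  rw [counts, hset, Set.encard_iUnion_of_finite, finsum_eq_sum_of_fintype]
  · refine Finset.sum_congr rfl fun J _ => ?_
    split_ifs <;> simp
  · intro J J' hne
    simp only [Function.onFun]
    split_ifs
    · exact (disjoint_atom I hne).mono Set.inter_subset_right Set.inter_subset_right
    all_goals simp

end Atoms

namespace IsPoissonProcess

variable {Ω : Type*} [MeasurableSpace Ω] {μ : Measure Ω} {d : ℕ} {lam : ℝ≥0}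
  {L L' : Ω → Set (EuclideanSpace ℝ (Fin d))}

lemma measurable_counts (hL : IsPoissonProcess μ lam L) : Measurable fun ω => counts (L ω) :=
  measurable_pi_lambda _ fun B => hL.measurable_count B.1 B.2.1 B.2.2

variable [IsProbabilityMeasure μ]

lemma map_counts_atom (hL : IsPoissonProcess μ lam L) (I : Finset (FiniteVolumeSet d)) :
    μ.map (fun ω (J : {J : Finset I // J.Nonempty}) => (L ω ∩ atom I J).encard) =
      Measure.pi fun J => (poissonMeasure (lam * (volume (atom I J)).toNNReal)).map
        (fun n : ℕ => (n : ℕ∞)) := by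
  classical
  let e := Fintype.equivFin {J : Finset I // J.Nonempty}
  have hind : iIndepFun (fun (J : {J : Finset I // J.Nonempty}) ω => (L ω ∩ atom I J).encard) μ := by
    have h := hL.indep_count _ (fun i => atom I (e.symm i)) (fun _ => measurableSet_atom I _)
      (fun _ => volume_atom_lt_top I _)
      (fun i j hij => disjoint_atom I (e.symm.injective.ne hij))
    have h2 := h.precomp e.injective
    simpa using h2
  rw [(iIndepFun_iff_map_fun_eq_pi_map fun J => (hL.measurable_count _ (measurableSet_atom I J)
    (volume_atom_lt_top I J)).aemeasurable).1 hind]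
  congr 1
  funext J
  exact hL.law_count _ (measurableSet_atom I J) (volume_atom_lt_top I J)

/-- All Poisson processes with the same intensity have the same law: the joint law of the counts in
finitely many sets is determined by the counts in the atoms, which are independent. -/
lemma map_counts_eq (hL : IsPoissonProcess μ lam L) (hL' : IsPoissonProcess μ lam L') :
    μ.map (fun ω => counts (L ω)) = μ.map (fun ω => counts (L' ω)) := by
  classical
  refine (map_eq_iff_forall_finset_map_restrict_eq (X := fun B ω => counts (L ω) B)
    (Y := fun B ω => counts (L' ω) B) hL.measurable_counts.aemeasurable
    hL'.measurable_counts.aemeasurable).2 fun I => ?_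
  set G : ({J : Finset I // J.Nonempty} → ℕ∞) → I → ℕ∞ := fun c B =>
    ∑ J, if B ∈ J.1 then c J else 0 with hG
  have hGm : Measurable G := by
    refine measurable_pi_lambda _ fun B => Finset.measurable_sum _ fun J _ => ?_
    split_ifs
    · exact measurable_pi_apply J
    · exact measurable_const
  have key : ∀ {K : Ω → Set (EuclideanSpace ℝ (Fin d))}, IsPoissonProcess μ lam K →
      μ.map (fun ω => I.restrict fun B => counts (K ω) B) = (Measure.pi fun J =>
        (poissonMeasure (lam * (volume (atom I J)).toNNReal)).map (fun n : ℕ => (n : ℕ∞))).map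
        G := by
    intro K hK
    rw [← hK.map_counts_atom I, Measure.map_map hGm]
    · congr 1
      funext ω B
      exact counts_eq_sum_atom I (K ω) B
    · exact measurable_pi_lambda _ fun J => hK.measurable_count _ (measurableSet_atom I J)
        (volume_atom_lt_top I J)
  rw [key hL, key hL']

end IsPoissonProcess

/-! ### Measurability of the matching -/

/-- A locally finite subset of `ℝ^d`. -/
structure Configuration (d : ℕ) : Type where
  /-- The points of the configuration. -/
  points : Set (EuclideanSpace ℝ (Fin d))
  locallyFinite : ∀ x r, (points ∩ Metric.closedBall x r).Finite

/-- The σ-algebra generated by the counts. -/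
noncomputable instance (d : ℕ) : MeasurableSpace (Configuration d) :=
  MeasurableSpace.comap (fun s => counts s.1) inferInstance

namespace Configuration

variable {d : ℕ}

local notation "𝔼" => EuclideanSpace ℝ (Fin d)

lemma measurable_encard {B : Set 𝔼} (hB : MeasurableSet B) (hB' : volume B < ∞) :
    Measurable fun s : Configuration d => (s.1 ∩ B).encard :=
  (measurable_pi_apply (⟨B, hB, hB'⟩ : FiniteVolumeSet d)).comp
    (comap_measurable fun s : Configuration d => counts s.1)

/-- A countable family of balls that isolates every point of every locally finite set. -/
noncomputable def cell (d : ℕ) (i : ℕ × ℕ) : Set (EuclideanSpace ℝ (Fin d)) :=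
  Metric.ball (TopologicalSpace.denseSeq (EuclideanSpace ℝ (Fin d)) i.1) (1 / (i.2 + 1 : ℝ))

lemma exists_inter_cell_eq (s : Configuration d) {x : 𝔼} (hx : x ∈ s.1) :
    ∃ i, s.1 ∩ cell d i = {x} := by
  have hclosed : IsClosed ((s.1 ∩ Metric.closedBall x 1) \ {x}) :=
    ((s.2 x 1).subset Set.sdiff_subset).isClosed
  obtain ⟨ε, hε, hball⟩ := Metric.isOpen_iff.1 hclosed.isOpen_compl x (by simp)
  obtain ⟨k, hk⟩ := exists_nat_one_div_lt (half_pos (lt_min hε one_pos))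
  have hk0 : (0 : ℝ) < 1 / (k + 1 : ℝ) := by positivity
  obtain ⟨n, hn⟩ := (TopologicalSpace.denseRange_denseSeq 𝔼).exists_dist_lt x hk0
  refine ⟨(n, k), Set.Subset.antisymm ?_ ?_⟩
  · rintro y ⟨hy, hyc⟩
    have hlt : dist y x < min ε 1 := by
      have h1 := dist_triangle_right y x (TopologicalSpace.denseSeq 𝔼 n)
      have h2 : dist y (TopologicalSpace.denseSeq 𝔼 n) < 1 / (k + 1 : ℝ) := hyc
      linarith
    by_contra hne
    exact hball (lt_of_lt_of_le hlt (min_le_left _ _))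
      ⟨⟨hy, (lt_of_lt_of_le hlt (min_le_right _ _)).le⟩, hne⟩
  · rintro _ rfl
    exact ⟨hx, hn⟩

open Classical in
/-- The point of `s` in the `i`-th cell, if there is exactly one; the value `0` otherwise is
arbitrary. -/
noncomputable def pointIn (i : ℕ × ℕ) (s : Configuration d) : 𝔼 :=
  if h : ∃ x, s.1 ∩ cell d i = {x} then h.choose else 0

lemma pointIn_eq {i : ℕ × ℕ} {s : Configuration d} {x : 𝔼} (h : s.1 ∩ cell d i = {x}) :
    pointIn i s = x := by
  have hex : ∃ x, s.1 ∩ cell d i = {x} := ⟨x, h⟩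
  rw [pointIn, dif_pos hex]
  exact (Set.singleton_injective (h.symm.trans hex.choose_spec)).symm

lemma measurableSet_cell (i : ℕ × ℕ) : MeasurableSet (cell d i) := measurableSet_ball

lemma volume_cell_lt_top (i : ℕ × ℕ) : volume (cell d i) < ∞ :=
  Metric.isBounded_ball.measure_lt_top

/-- That the point in a cell belongs to `B` is an event about the counts in the cell and in its
intersection with `B`. -/
lemma measurable_pointIn (i : ℕ × ℕ) : Measurable (pointIn (d := d) i) := by
  intro B hB
  have h1 := measurable_encard (measurableSet_cell (d := d) i) (volume_cell_lt_top i)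
  have h2 := measurable_encard ((measurableSet_cell (d := d) i).inter hB)
    ((measure_mono Set.inter_subset_left).trans_lt (volume_cell_lt_top i))
  have hset : pointIn (d := d) i ⁻¹' B =
      ((fun s : Configuration d => (s.1 ∩ cell d i).encard) ⁻¹' {1} ∩
        (fun s : Configuration d => (s.1 ∩ (cell d i ∩ B)).encard) ⁻¹' {1}) ∪
      ((fun s : Configuration d => (s.1 ∩ cell d i).encard) ⁻¹' {1}ᶜ ∩ {_s | (0 : 𝔼) ∈ B}) := by
    ext s
    by_cases h : ∃ x, s.1 ∩ cell d i = {x}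
    · obtain ⟨x, hx⟩ := h
      have : ({x} ∩ B).encard = 1 ↔ x ∈ B := by
        by_cases hxB : x ∈ B
        · simp [Set.inter_eq_left.2 (Set.singleton_subset_iff.2 hxB), hxB]
        · simp [Set.singleton_inter_eq_empty.2 hxB, hxB]
      simp [pointIn_eq hx, ← Set.inter_assoc, hx, this]
    · have h1 : (s.1 ∩ cell d i).encard ≠ 1 := fun h' => h (Set.encard_eq_one.1 h')
      simp [pointIn, dif_neg h, h1]
  rw [hset]
  exact ((h1 (measurableSet_singleton 1)).inter (h2 (measurableSet_singleton 1))).union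
    ((h1 (measurableSet_singleton 1).compl).inter (MeasurableSet.const _))

/-- Quantification over the points of a configuration is quantification over countably many
measurable functions of it, and therefore preserves measurability. -/
lemma measurable_exists {P : Configuration d → 𝔼 → Prop}
    (hP : ∀ f : Configuration d → 𝔼, Measurable f → Measurable fun s => P s (f s)) :
    Measurable fun s : Configuration d => ∃ x ∈ s.1, P s x := by
  have h : (fun s : Configuration d => ∃ x ∈ s.1, P s x) =
      fun s => ∃ i, (s.1 ∩ cell d i).encard = 1 ∧ P s (pointIn i s) := by
    funext s
    refine propext ⟨?_, ?_⟩
    · rintro ⟨x, hx, hP⟩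
      obtain ⟨i, hi⟩ := s.exists_inter_cell_eq hx
      exact ⟨i, by rw [hi, Set.encard_singleton], by rwa [pointIn_eq hi]⟩
    · rintro ⟨i, hi, hP⟩
      obtain ⟨x, hx⟩ := Set.encard_eq_one.1 hi
      rw [pointIn_eq hx] at hP
      have : x ∈ s.1 ∩ cell d i := by rw [hx]; rfl
      exact ⟨x, this.1, hP⟩
  rw [h]
  refine Measurable.exists fun i => Measurable.and ?_ (hP _ (measurable_pointIn i))
  exact measurableSet_setOfPred.1
    (measurable_encard (measurableSet_cell i) (volume_cell_lt_top i) (measurableSet_singleton 1))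

lemma measurable_forall {P : Configuration d → 𝔼 → Prop}
    (hP : ∀ f : Configuration d → 𝔼, Measurable f → Measurable fun s => P s (f s)) :
    Measurable fun s : Configuration d => ∀ x ∈ s.1, P s x := by
  have h := (measurable_exists (P := fun s x => ¬ P s x) fun f hf => (hP f hf).not).not
  simpa using h

lemma measurable_mem {f : Configuration d → 𝔼} (hf : Measurable f) :
    Measurable fun s : Configuration d => f s ∈ s.1 := by
  have h := measurable_exists (P := fun s x => x = f s) fun g hg =>
    measurableSet_setOfPred.1 (measurableSet_eq_fun hg hf)
  simpa using h

lemma measurable_ne {f g : Configuration d → 𝔼} (hf : Measurable f) (hg : Measurable g) :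
    Measurable fun s : Configuration d => f s ≠ g s :=
  (measurableSet_setOfPred.1 (measurableSet_eq_fun hf hg)).not

lemma measurable_dist_lt {f g f' g' : Configuration d → 𝔼} (hf : Measurable f) (hg : Measurable g)
    (hf' : Measurable f') (hg' : Measurable g') :
    Measurable fun s : Configuration d => dist (f s) (g s) < dist (f' s) (g' s) :=
  measurableSet_setOfPred.1 (measurableSet_lt (hf.dist hg) (hf'.dist hg'))

end Configuration

/-- A form of the recursion in which the quantifiers range over single points. -/
lemma losingWithin_succ_iff {E : Type*} [MetricSpace E] {s : Set E} {n : ℕ} {x y : E} :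
    LosingWithin s (n + 1) (x, y) ↔ x ∈ s ∧ y ∈ s ∧ x ≠ y ∧
      ((∃ z ∈ s, x ≠ z ∧ dist x z < dist x y) ∨ (∃ z ∈ s, z ≠ y ∧ dist z y < dist x y)) ∧
      (∀ z ∈ s, x ≠ z → dist x z < dist x y → ¬ LosingWithin s n (x, z)) ∧
      (∀ z ∈ s, z ≠ y → dist z y < dist x y → ¬ LosingWithin s n (z, y)) := by
  constructor
  · rintro ⟨⟨hx, hy, hxy⟩, ⟨⟨a, b⟩, ⟨ha, hb, hab⟩, hq⟩, hall⟩
    refine ⟨hx, hy, hxy, ?_, fun z hz h1 h2 => hall (x, z) ⟨⟨hx, hz, h1⟩, Or.inl rfl, h2⟩,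
      fun z hz h1 h2 => hall (z, y) ⟨⟨hz, hy, h1⟩, Or.inr rfl, h2⟩⟩
    obtain ⟨h | h, hlt⟩ := hq <;> simp only at ha hb hab h hlt
    · subst h
      exact Or.inl ⟨b, hb, hab, hlt⟩
    · subst h
      exact Or.inr ⟨a, ha, hab, hlt⟩
  · rintro ⟨hx, hy, hxy, hex, h1, h2⟩
    refine ⟨⟨hx, hy, hxy⟩, ?_, ?_⟩
    · rcases hex with ⟨z, hz, hne, hlt⟩ | ⟨z, hz, hne, hlt⟩
      · exact ⟨(x, z), ⟨hx, hz, hne⟩, Or.inl rfl, hlt⟩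
      · exact ⟨(z, y), ⟨hz, hy, hne⟩, Or.inr rfl, hlt⟩
    · rintro ⟨a, b⟩ ⟨⟨ha, hb, hab⟩, h | h, hlt⟩ <;> simp only at ha hb hab h hlt
      · subst h
        exact h1 b hb hab hlt
      · subst h
        exact h2 a ha hab hlt

namespace Configuration

variable {d : ℕ}

local notation "𝔼" => EuclideanSpace ℝ (Fin d)

lemma measurable_losingWithin (n : ℕ) : ∀ {f g : Configuration d → 𝔼}, Measurable f →
    Measurable g → Measurable fun s : Configuration d => LosingWithin s.1 n (f s, g s) := by
  induction n with
  | zero => exact fun _ _ => measurable_const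
  | succ n ih =>
    intro f g hf hg
    simp only [losingWithin_succ_iff]
    refine (measurable_mem hf).and ((measurable_mem hg).and ((measurable_ne hf hg).and
      (Measurable.and (Measurable.or ?_ ?_) (Measurable.and ?_ ?_))))
    · exact measurable_exists (P := fun s z => f s ≠ z ∧ dist (f s) z < dist (f s) (g s))
        fun h hh => (measurable_ne hf hh).and (measurable_dist_lt hf hh hf hg)
    · exact measurable_exists (P := fun s z => z ≠ g s ∧ dist z (g s) < dist (f s) (g s))
        fun h hh => (measurable_ne hh hg).and (measurable_dist_lt hh hg hf hg)
    · exact measurable_forall (P := fun s z => f s ≠ z → dist (f s) z < dist (f s) (g s) →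
        ¬ LosingWithin s.1 n (f s, z)) fun h hh =>
          (measurable_ne hf hh).imp ((measurable_dist_lt hf hh hf hg).imp (ih hf hh).not)
    · exact measurable_forall (P := fun s z => z ≠ g s → dist z (g s) < dist (f s) (g s) →
        ¬ LosingWithin s.1 n (z, g s)) fun h hh =>
          (measurable_ne hh hg).imp ((measurable_dist_lt hh hg hf hg).imp (ih hh hg).not)

lemma measurable_losing {f g : Configuration d → 𝔼} (hf : Measurable f) (hg : Measurable g) :
    Measurable fun s : Configuration d => Losing s.1 (f s, g s) :=
  Measurable.exists fun _ => Measurable.forall fun n => measurable_const.imp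
    (measurable_losingWithin n hf hg)

/-- The configurations with an unmatched point in the ball of radius `R` around the origin. -/
def unmatchedIn (d : ℕ) (R : ℝ) : Set (Configuration d) :=
  {s | ∃ x ∈ s.1, ‖x‖ < R ∧ ∀ y ∈ s.1, ¬ Losing s.1 (x, y)}

lemma measurableSet_unmatchedIn (R : ℝ) : MeasurableSet (unmatchedIn d R) := by
  refine measurableSet_setOfPred.2 (measurable_exists
    (P := fun s x => ‖x‖ < R ∧ ∀ y ∈ s.1, ¬ Losing s.1 (x, y)) fun f hf => Measurable.and ?_ ?_)
  · exact measurableSet_setOfPred.1 (measurableSet_lt hf.norm measurable_const)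
  · exact measurable_forall (P := fun s y => ¬ Losing s.1 (f s, y)) fun g hg =>
      (measurable_losing hf hg).not

end Configuration

/-! ### Translation invariance and perfectness -/

section Translation

variable {d : ℕ} {s : Set (EuclideanSpace ℝ (Fin d))}

local notation "𝔼" => EuclideanSpace ℝ (Fin d)

lemma isPair_preimage_add (v : 𝔼) (p : 𝔼 × 𝔼) :
    IsPair ((· + v) ⁻¹' s) p ↔ IsPair s (p.1 + v, p.2 + v) := by
  simp [IsPair]

lemma step_preimage_add (v : 𝔼) (q p : 𝔼 × 𝔼) :
    Step ((· + v) ⁻¹' s) q p ↔ Step s (q.1 + v, q.2 + v) (p.1 + v, p.2 + v) := by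
  simp [Step, isPair_preimage_add]

lemma losingWithin_preimage_add (v : 𝔼) (n : ℕ) : ∀ p : 𝔼 × 𝔼,
    LosingWithin ((· + v) ⁻¹' s) n p ↔ LosingWithin s n (p.1 + v, p.2 + v) := by
  have hsurj : Function.Surjective fun q : 𝔼 × 𝔼 => (q.1 + v, q.2 + v) :=
    fun q => ⟨(q.1 - v, q.2 - v), by simp⟩
  induction n with
  | zero => exact fun _ => Iff.rfl
  | succ n ih =>
    intro p
    simp only [LosingWithin, isPair_preimage_add, step_preimage_add, ih]
    refine and_congr_right fun _ => and_congr ?_ ?_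
    · exact (hsurj.exists (p := fun q => Step s q (p.1 + v, p.2 + v))).symm
    · exact (hsurj.forall (p := fun q => Step s q (p.1 + v, p.2 + v) →
        ¬ LosingWithin s n q)).symm

lemma losing_preimage_add (v : 𝔼) (p : 𝔼 × 𝔼) :
    Losing ((· + v) ⁻¹' s) p ↔ Losing s (p.1 + v, p.2 + v) := by
  simp only [Losing, losingWithin_preimage_add]

end Translation

namespace IsPoissonProcess

variable {Ω : Type*} [MeasurableSpace Ω] {μ : Measure Ω} {d : ℕ}
  {lam : ℝ≥0} {L : Ω → Set (EuclideanSpace ℝ (Fin d))}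

lemma translate (hL : IsPoissonProcess μ lam L) (v : EuclideanSpace ℝ (Fin d)) :
    IsPoissonProcess μ lam fun ω => (· + v) ⁻¹' L ω := by
  have hcount : ∀ (ω : Ω) (B : Set (EuclideanSpace ℝ (Fin d))),
      ((· + v) ⁻¹' L ω ∩ B).encard = (L ω ∩ (· + -v) ⁻¹' B).encard := by
    intro ω B
    rw [← (add_left_injective v).encard_image]
    congr 1
    ext y
    constructor
    · rintro ⟨x, ⟨hx, hxB⟩, rfl⟩
      exact ⟨hx, by simpa using hxB⟩
    · rintro ⟨hy, hyB⟩
      exact ⟨y + -v, ⟨by simpa using hy, hyB⟩, by simp⟩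
  have hmeas : ∀ {B : Set (EuclideanSpace ℝ (Fin d))}, MeasurableSet B →
      MeasurableSet ((· + -v) ⁻¹' B) := fun hB => measurable_add_const (-v) hB
  have hvol : ∀ B : Set (EuclideanSpace ℝ (Fin d)), volume ((· + -v) ⁻¹' B) = volume B :=
    fun B => measure_preimage_add_right volume (-v) B
  refine ⟨fun B hB hB' => ?_, fun B hB hB' => ?_, fun n B hB hB' hdisj => ?_⟩
  · simp only [hcount]
    exact hL.measurable_count _ (hmeas hB) (by rwa [hvol])
  · simp only [hcount]
    rw [hL.law_count _ (hmeas hB) (by rwa [hvol]), hvol]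
  · simp only [hcount]
    exact hL.indep_count n _ (fun i => hmeas (hB i)) (fun i => by rw [hvol]; exact hB' i)
      fun i j hij => (hdisj i j hij).preimage _

/-- An event that depends measurably on the configuration is null measurable, and equally likely for
the process and for its translates. -/
lemma nullMeasurableSet_and_measure_translate_eq [IsProbabilityMeasure μ]
    (hL : IsPoissonProcess μ lam L)
    {A : Set (Configuration d)} (hA : MeasurableSet A) :
    (∀ v, NullMeasurableSet
      {ω | ∃ h, (⟨(· + v) ⁻¹' L ω, h⟩ : Configuration d) ∈ A} μ) ∧
    ∀ v, μ {ω | ∃ h, (⟨(· + v) ⁻¹' L ω, h⟩ : Configuration d) ∈ A} =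
      μ {ω | ∃ h, (⟨L ω, h⟩ : Configuration d) ∈ A} := by
  -- Such an event is given, up to the null set where the process is not locally finite, by a
  -- measurable set of counts.
  obtain ⟨t, ht, rfl⟩ := hA
  have hae : ∀ {K : Ω → Set (EuclideanSpace ℝ (Fin d))}, IsPoissonProcess μ lam K →
      {ω | ∃ h, (⟨K ω, h⟩ : Configuration d) ∈ (fun s : Configuration d => counts s.1) ⁻¹' t}
        =ᵐ[μ] (fun ω => counts (K ω)) ⁻¹' t := by
    intro K hK
    filter_upwards [hK.ae_locallyFinite] with ω hω
    refine propext ⟨fun ⟨_, h⟩ => h, fun h => ⟨hω, h⟩⟩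
  refine ⟨fun v => ?_, fun v => ?_⟩
  · exact ((hL.translate v).measurable_counts ht).nullMeasurableSet.congr
      (hae (hL.translate v)).symm
  · rw [measure_congr (hae hL), measure_congr (hae (hL.translate v)),
      ← Measure.map_apply hL.measurable_counts ht,
      ← Measure.map_apply (hL.translate v).measurable_counts ht,
      (hL.translate v).map_counts_eq hL]

variable [IsProbabilityMeasure μ]

/-- The events that there is an unmatched point in the translates of a ball are equally likely. As
there are only finitely many unmatched points, at most finitely many of these events occur for the
translates by the multiples of a unit vector, and so the events have probability zero. -/
lemma ae_not_mem_unmatchedIn (hL : IsPoissonProcess μ lam L) (hd : 1 ≤ d) (hlam : 0 < lam)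
    (R : ℝ) :
    ∀ᵐ ω ∂μ, ¬ ∃ h, (⟨L ω, h⟩ : Configuration d) ∈ Configuration.unmatchedIn d R := by
  obtain ⟨hnull, heq⟩ :=
    hL.nullMeasurableSet_and_measure_translate_eq
      (Configuration.measurableSet_unmatchedIn (d := d) R)
  set e : EuclideanSpace ℝ (Fin d) := EuclideanSpace.single ⟨0, hd⟩ 1 with he
  have hnorm : ∀ k : ℕ, ‖(k : ℝ) • e‖ = k := fun k => by simp [he, norm_smul]
  set A : ℕ → Set Ω := fun k => {ω | ∃ h, (⟨(· + (k : ℝ) • e) ⁻¹' L ω, h⟩ : Configuration d) ∈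
    Configuration.unmatchedIn d R} with hA
  set B : ℕ → Set Ω := fun N => ⋃ k ≥ N, A k with hB
  have hBanti : Antitone B := fun N N' h => Set.biUnion_subset_biUnion_left fun k hk => le_trans h hk
  have hBnull : ∀ N, NullMeasurableSet (B N) μ := fun N =>
    NullMeasurableSet.biUnion (Set.to_countable _) fun k _ => hnull _
  have hlim := tendsto_measure_iInter_atTop (μ := μ) hBnull hBanti ⟨0, measure_ne_top μ _⟩
  have hInter : μ (⋂ N, B N) = 0 := by
    rw [measure_eq_zero_iff_ae_notMem]
    filter_upwards [hL.ae_generic hd hlam] with ω hω hmem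
    obtain ⟨C, hC⟩ := (hω.finite_unmatched.image fun x => ‖x‖).bddAbove
    obtain ⟨N, hN⟩ := exists_nat_gt (C + R)
    obtain ⟨k, hk, hkA⟩ := Set.mem_iUnion₂.1 (Set.mem_iInter.1 hmem N)
    obtain ⟨_, x, hx, hxR, hxu⟩ := hkA
    have hunm : x + (k : ℝ) • e ∈ {x | x ∈ L ω ∧ ∀ y, ¬ Losing (L ω) (x, y)} := by
      refine ⟨hx, fun y hy => hxu (y - (k : ℝ) • e) ?_ ?_⟩
      · simpa using hy.isPair.2.1
      · simpa [losing_preimage_add] using hy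
    have h1 : ‖x + (k : ℝ) • e‖ ≤ C := hC ⟨_, hunm, rfl⟩
    have h2 : ‖(k : ℝ) • e‖ ≤ ‖x + (k : ℝ) • e‖ + ‖x‖ := by
      simpa using norm_sub_le (x + (k : ℝ) • e) x
    rw [hnorm] at h2
    have h3 : (N : ℝ) ≤ k := by exact_mod_cast hk
    linarith
  rw [hInter] at hlim
  have hzero : μ {ω | ∃ h, (⟨L ω, h⟩ : Configuration d) ∈ Configuration.unmatchedIn d R} = 0 := by
    refine le_antisymm (ge_of_tendsto' hlim fun N => ?_) zero_le
    rw [← heq ((N : ℝ) • e)]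
    exact measure_mono (Set.subset_biUnion_of_mem (u := A) (le_refl N))
  exact measure_eq_zero_iff_ae_notMem.1 hzero

lemma ae_exists_losing (hL : IsPoissonProcess μ lam L) (hd : 1 ≤ d) (hlam : 0 < lam) :
    ∀ᵐ ω ∂μ, ∀ x ∈ L ω, ∃ y, Losing (L ω) (x, y) := by
  filter_upwards [ae_all_iff.2 fun n : ℕ => hL.ae_not_mem_unmatchedIn hd hlam n,
    hL.ae_locallyFinite] with ω hω hfin x hx
  by_contra! hno
  obtain ⟨n, hn⟩ := exists_nat_gt ‖x‖
  exact hω n ⟨hfin, x, hx, hn, fun y _ => hno y⟩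

end IsPoissonProcess

end FriendlyFrogs

theorem mainTheorem12 {Ω : Type*} [MeasurableSpace Ω] (μ : Measure Ω) [IsProbabilityMeasure μ]
    (d : ℕ) (hd : 1 ≤ d) (lam : ℝ≥0) (hlam : 0 < lam)
    (L : Ω → Set (EuclideanSpace ℝ (Fin d)))
    (hL : FriendlyFrogs.IsPoissonProcess μ lam L) :
    ∀ᵐ ω ∂μ,
      FriendlyFrogs.MisereWinForBob (L ω) ∧
      ∃ M : Set (Sym2 (EuclideanSpace ℝ (Fin d))),
        FriendlyFrogs.IsRestrictedStableMatching (L ω) M ∧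
        (∀ M', FriendlyFrogs.IsRestrictedStableMatching (L ω) M' → M' = M) ∧
        FriendlyFrogs.Covers (L ω) M := by
  filter_upwards [hL.ae_generic hd hlam, hL.ae_nonempty hd hlam, hL.ae_exists_losing hd hlam] with
    ω hgen hne hcov
  refine ⟨hgen.misereWinForBob hne hcov, FriendlyFrogs.losingMatching (L ω),
    hgen.isRestrictedStableMatching_losingMatching, fun M' hM' => hgen.eq_losingMatching hM',
    fun x hx => ?_⟩
  obtain ⟨y, hy⟩ := hcov x hx
  exact ⟨y, FriendlyFrogs.mem_losingMatching.2 hy⟩
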